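/- An axis-parallel square annulus $A$ is the region between two concentric axis-parallel squares $S'\subseteq S$ of radii (half side lengths) $0\le r'\le r$, where the inner square $S'$ may degenerate to a single point; its width is $r-r'$. For a finite point set $P\subset\mathbb{R}^2$, the annulus is called empty if no point of $P$ lies in its interior, that is, in the interior of $S$ but not in $S'$ (boundary included). An empty annulus is called valid if at least one point of $P$ lies in $S'$ (in its interior or on its boundary) and at least one point of $P$ does not. Theorem. Given a set $P$ of $n\ge 2$ points in the plane, a valid empty axis-parallel square annulus of maximum width can be computed in $O(n^3)$ time using $O(n)$ space. Here the model of computation is the real RAM: memory cells hold either exact real numbers or words of $O(\log n)$ bits, and comparisons, memory accesses (also through computed indices), the operations $+,-,\times,\div$ on reals and $+,-,\times$ on words have unit cost; reals cannot be rounded or converted to words. The input is given as the number $n$ and the coordinates of the points in arbitrary order, and the output consists of the center, the outer radius and the inner radius of the annulus. In detail: there are one program and one constant $C$ such that, for every $n\ge2$ and every set of $n$ points, the program halts after at most $Cn^3$ steps with a correct output, while it uses finitely many registers (a number that depends only on the program), at most $Cn$ cells of each of its finitely many arrays, and only words smaller than $n^C$. -/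

import Mathlib

/-! ### Axis-parallel square annuli -/

/-- The (closed, axis-parallel) square with center `c` and radius `r`, that is, side length `2 * r`. -/
def axisSquare (c : ℝ × ℝ) (r : ℝ) : Set (ℝ × ℝ) :=
  {q | |q.1 - c.1| ≤ r ∧ |q.2 - c.2| ≤ r}

/-- An axis-parallel square annulus, given by two concentric axis-parallel squares, the inner one
contained in the outer one. The inner square may degenerate to the point `center`. -/
structure SquareAnnulus where
  center : ℝ × ℝ
  outerRadius : ℝ
  innerRadius : ℝ
  inner_nonneg : 0 ≤ innerRadius
  inner_le_outer : innerRadius ≤ outerRadius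

namespace SquareAnnulus

def outerSquare (A : SquareAnnulus) : Set (ℝ × ℝ) := axisSquare A.center A.outerRadius

def innerSquare (A : SquareAnnulus) : Set (ℝ × ℝ) := axisSquare A.center A.innerRadius

/-- The region between the two squares. The boundary of the inner square is left out, which changes
the interior only when the inner square is a single point: that point does not belong to it. -/
def region (A : SquareAnnulus) : Set (ℝ × ℝ) := A.outerSquare \ A.innerSquare

def width (A : SquareAnnulus) : ℝ := A.outerRadius - A.innerRadius

/-- No point of `P` lies in the interior of the annulus. -/
def IsEmptyOf (A : SquareAnnulus) (P : Set (ℝ × ℝ)) : Prop := Disjoint (interior A.region) P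

/-- The points of `P` in the interior or on the boundary of the inner square. -/
def pointsIn (A : SquareAnnulus) (P : Set (ℝ × ℝ)) : Set (ℝ × ℝ) := P ∩ A.innerSquare

def pointsOut (A : SquareAnnulus) (P : Set (ℝ × ℝ)) : Set (ℝ × ℝ) := P \ A.pointsIn P

def IsValidFor (A : SquareAnnulus) (P : Set (ℝ × ℝ)) : Prop :=
  (A.pointsOut P).Nonempty ∧ (A.pointsIn P).Nonempty

/-- `A` is a valid empty square annulus for `P`, of maximum width among all of these. -/
def IsMaxWidthValidEmpty (A : SquareAnnulus) (P : Set (ℝ × ℝ)) : Prop :=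
  A.IsEmptyOf P ∧ A.IsValidFor P ∧
    ∀ B : SquareAnnulus, B.IsEmptyOf P → B.IsValidFor P → B.width ≤ A.width

end SquareAnnulus

/-! ### The real RAM

A real RAM works on words (natural numbers below a limit) and on exact real numbers. Programs are
structured. A program refers by literal indices to its registers and arrays, of which it therefore
has finitely many; array cells are addressed by computed words. There is no operation that turns
a real number into a word. -/

namespace RealRAM

/-- `cells` is the number of cells of each array, and every word is below `wordBound`. An access
outside the array or a word that is too large is illegal. -/
structure Limits where
  cells : ℕ
  wordBound : ℕ

/-- Memory contents: registers, and the arrays (array name, then index). -/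
structure Memory where
  wordReg : ℕ → ℕ
  realReg : ℕ → ℝ
  wordArr : ℕ → ℕ → ℕ
  realArr : ℕ → ℕ → ℝ

/-- Word expressions; the subtraction is truncated at zero. -/
inductive WordExp : Type where
  | lit (k : ℕ)
  | reg (i : ℕ)
  | get (a : ℕ) (idx : WordExp)
  | add (u v : WordExp)
  | sub (u v : WordExp)
  | mul (u v : WordExp)

/-- Real expressions: rational constants, memory access and the four arithmetic operations. -/
inductive RealExp : Type where
  | lit (q : ℚ)
  | reg (i : ℕ)
  | get (a : ℕ) (idx : WordExp)
  | add (u v : RealExp)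
  | sub (u v : RealExp)
  | mul (u v : RealExp)
  | div (u v : RealExp)

/-- Tests: comparisons of words and of reals, negation, and conjunction evaluated from the left. -/
inductive Test : Type where
  | wordLt (u v : WordExp)
  | realLt (u v : RealExp)
  | neg (b : Test)
  | conj (b c : Test)

inductive Program : Type where
  | nop
  | setWord (i : ℕ) (e : WordExp)
  | setReal (i : ℕ) (e : RealExp)
  | putWord (a : ℕ) (idx : WordExp) (e : WordExp)
  | putReal (a : ℕ) (idx : WordExp) (e : RealExp)
  | seq (c d : Program)
  | cond (b : Test) (c d : Program)
  | loop (b : Test) (c : Program)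

namespace WordExp

def val (m : Memory) : WordExp → ℕ
  | lit k => k
  | reg i => m.wordReg i
  | get a idx => m.wordArr a (idx.val m)
  | add u v => u.val m + v.val m
  | sub u v => u.val m - v.val m
  | mul u v => u.val m * v.val m

/-- The evaluation accesses only existing cells and meets only words below the bound. -/
def Legal (L : Limits) (m : Memory) : WordExp → Prop
  | lit k => k < L.wordBound
  | reg i => m.wordReg i < L.wordBound
  | get a idx => idx.Legal L m ∧ idx.val m < L.cells ∧ m.wordArr a (idx.val m) < L.wordBound
  | add u v => u.Legal L m ∧ v.Legal L m ∧ u.val m + v.val m < L.wordBound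
  | sub u v => u.Legal L m ∧ v.Legal L m
  | mul u v => u.Legal L m ∧ v.Legal L m ∧ u.val m * v.val m < L.wordBound

/-- Each constant, memory access and operation costs one step. -/
def cost : WordExp → ℕ
  | lit _ => 1
  | reg _ => 1
  | get _ idx => idx.cost + 1
  | add u v => u.cost + v.cost + 1
  | sub u v => u.cost + v.cost + 1
  | mul u v => u.cost + v.cost + 1

end WordExp

namespace RealExp

noncomputable def val (m : Memory) : RealExp → ℝ
  | lit q => (q : ℝ)
  | reg i => m.realReg i
  | get a idx => m.realArr a (idx.val m)
  | add u v => u.val m + v.val m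
  | sub u v => u.val m - v.val m
  | mul u v => u.val m * v.val m
  | div u v => u.val m / v.val m

/-- The evaluation accesses only existing cells and never divides by zero. -/
def Legal (L : Limits) (m : Memory) : RealExp → Prop
  | lit _ => True
  | reg _ => True
  | get _ idx => idx.Legal L m ∧ idx.val m < L.cells
  | add u v => u.Legal L m ∧ v.Legal L m
  | sub u v => u.Legal L m ∧ v.Legal L m
  | mul u v => u.Legal L m ∧ v.Legal L m
  | div u v => u.Legal L m ∧ v.Legal L m ∧ v.val m ≠ 0

def cost : RealExp → ℕ
  | lit _ => 1
  | reg _ => 1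
  | get _ idx => idx.cost + 1
  | add u v => u.cost + v.cost + 1
  | sub u v => u.cost + v.cost + 1
  | mul u v => u.cost + v.cost + 1
  | div u v => u.cost + v.cost + 1

end RealExp

namespace Test

def Holds (m : Memory) : Test → Prop
  | wordLt u v => u.val m < v.val m
  | realLt u v => u.val m < v.val m
  | neg b => ¬ b.Holds m
  | conj b c => b.Holds m ∧ c.Holds m

def Legal (L : Limits) (m : Memory) : Test → Prop
  | wordLt u v => u.Legal L m ∧ v.Legal L m
  | realLt u v => u.Legal L m ∧ v.Legal L m
  | neg b => b.Legal L m
  | conj b c => b.Legal L m ∧ (b.Holds m → c.Legal L m)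

def cost : Test → ℕ
  | wordLt u v => u.cost + v.cost + 1
  | realLt u v => u.cost + v.cost + 1
  | neg b => b.cost + 1
  | conj b c => b.cost + c.cost + 1

end Test

namespace Memory

def setWord (m : Memory) (i k : ℕ) : Memory :=
  { m with wordReg := Function.update m.wordReg i k }

noncomputable def setReal (m : Memory) (i : ℕ) (x : ℝ) : Memory :=
  { m with realReg := Function.update m.realReg i x }

def putWord (m : Memory) (a i k : ℕ) : Memory :=
  { m with wordArr := Function.update m.wordArr a (Function.update (m.wordArr a) i k) }

noncomputable def putReal (m : Memory) (a i : ℕ) (x : ℝ) : Memory :=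
  { m with realArr := Function.update m.realArr a (Function.update (m.realArr a) i x) }

/-- The initial memory on the input points `p 0, …, p (n - 1)`: word register `0` holds `n`, the
real arrays `0` and `1` hold the `x`- and the `y`-coordinates, and everything else is zero. -/
noncomputable def input {n : ℕ} (p : Fin n → ℝ × ℝ) : Memory where
  wordReg := fun i => if i = 0 then n else 0
  realReg := fun _ => 0
  wordArr := fun _ _ => 0
  realArr := fun a i =>
    if h : i < n then
      if a = 0 then (p ⟨i, h⟩).1 else if a = 1 then (p ⟨i, h⟩).2 else 0
    else 0

end Memory

/-- `Run L c m t m'`: within the limits `L`, the program `c` started on the memory `m` performs only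
legal operations and halts after exactly `t` steps with the memory `m'`. -/
inductive Run (L : Limits) : Program → Memory → ℕ → Memory → Prop where
  | nop (m : Memory) : Run L Program.nop m 1 m
  | setWord (m : Memory) (i : ℕ) (e : WordExp) (he : e.Legal L m) :
      Run L (Program.setWord i e) m (e.cost + 1) (m.setWord i (e.val m))
  | setReal (m : Memory) (i : ℕ) (e : RealExp) (he : e.Legal L m) :
      Run L (Program.setReal i e) m (e.cost + 1) (m.setReal i (e.val m))
  | putWord (m : Memory) (a : ℕ) (idx e : WordExp) (hidx : idx.Legal L m)
      (hlt : idx.val m < L.cells) (he : e.Legal L m) :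
      Run L (Program.putWord a idx e) m (idx.cost + e.cost + 1)
        (m.putWord a (idx.val m) (e.val m))
  | putReal (m : Memory) (a : ℕ) (idx : WordExp) (e : RealExp) (hidx : idx.Legal L m)
      (hlt : idx.val m < L.cells) (he : e.Legal L m) :
      Run L (Program.putReal a idx e) m (idx.cost + e.cost + 1)
        (m.putReal a (idx.val m) (e.val m))
  | seq (c d : Program) (m₁ m₂ m₃ : Memory) (s t : ℕ)
      (hc : Run L c m₁ s m₂) (hd : Run L d m₂ t m₃) :
      Run L (Program.seq c d) m₁ (s + t) m₃
  | condTrue (b : Test) (c d : Program) (m m' : Memory) (t : ℕ)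
      (hb : b.Legal L m) (h : b.Holds m) (hc : Run L c m t m') :
      Run L (Program.cond b c d) m (b.cost + t + 1) m'
  | condFalse (b : Test) (c d : Program) (m m' : Memory) (t : ℕ)
      (hb : b.Legal L m) (h : ¬ b.Holds m) (hd : Run L d m t m') :
      Run L (Program.cond b c d) m (b.cost + t + 1) m'
  | loopDone (b : Test) (c : Program) (m : Memory)
      (hb : b.Legal L m) (h : ¬ b.Holds m) :
      Run L (Program.loop b c) m (b.cost + 1) m
  | loopStep (b : Test) (c : Program) (m₁ m₂ m₃ : Memory) (s t : ℕ)
      (hb : b.Legal L m₁) (h : b.Holds m₁) (hc : Run L c m₁ s m₂)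
      (hrest : Run L (Program.loop b c) m₂ t m₃) :
      Run L (Program.loop b c) m₁ (b.cost + s + t + 1) m₃

/-- The output convention: the real registers `0, 1, 2, 3` hold the coordinates of the center, the
outer radius and the inner radius of the annulus. -/
def Memory.Outputs (m : Memory) (A : SquareAnnulus) : Prop :=
  m.realReg 0 = A.center.1 ∧ m.realReg 1 = A.center.2 ∧
    m.realReg 2 = A.outerRadius ∧ m.realReg 3 = A.innerRadius

end RealRAM

/-!
In the sup metric of the plane, a valid empty annulus of positive width is a center `c` together
with a gap in the distances of the points from `c`. Given such a gap, push the left and the right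
side of the outer square outwards to the nearest points that block them, or to sentinels far away,
and then the other two sides. The points in the resulting rectangle are those of the inner square,
and they leave room for the same width along every side. A square on the shorter side of the
rectangle that contains these points suitably centered therefore yields an annulus of the same
width whose outer square spans the vertical or horizontal strip between two points. So it suffices
to search `O(n²)` strips in each direction, and this in linear time per strip.

Let the strip have half-width `r`, and let `u₁ ≤ … ≤ uₖ` be the heights of the points in it and
`μ₁, …, μₖ` their distances to its boundary. An outer square that contains exactly the points of a
window `i ≤ l < j` has its center at a height from `uᵢ₋₁ + r` to `uⱼ - r`, and the best height is
the one nearest to `(uᵢ + uⱼ₋₁) / 2`; the width is then the smallest of the `μₗ` in the window and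
the two vertical distances. Both ends of the window only move upwards, and the minimum of the `μₗ`
is maintained in constant amortized time by a queue made of two stacks.
-/

/-! ### Gaps in the distances from a center -/

/-- No point of `P` has a distance strictly between `s` and `r` from `c`, while some points lie on
either side of this gap. In the sup metric of the plane these are the valid empty square annuli of
positive width. -/
structure IsValidGap {α : Type*} [PseudoMetricSpace α] (P : Set α) (c : α) (s r : ℝ) : Prop where
  nonneg : 0 ≤ s
  lt : s < r
  dist_le_or_le : ∀ p ∈ P, dist p c ≤ s ∨ r ≤ dist p c
  exists_dist_le : ∃ p ∈ P, dist p c ≤ s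
  exists_le_dist : ∃ p ∈ P, r ≤ dist p c

theorem IsValidGap.image {α β : Type*} [PseudoMetricSpace α] [PseudoMetricSpace β] {P : Set α}
    {c : α} {s r : ℝ} {f : α → β} (hf : Isometry f) (h : IsValidGap P c s r) :
    IsValidGap (f '' P) (f c) s r where
  nonneg := h.nonneg
  lt := h.lt
  dist_le_or_le := by
    simpa only [Set.forall_mem_image, hf.dist_eq] using h.dist_le_or_le
  exists_dist_le := by simpa only [Set.exists_mem_image, hf.dist_eq] using h.exists_dist_le
  exists_le_dist := by simpa only [Set.exists_mem_image, hf.dist_eq] using h.exists_le_dist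

theorem exists_isValidGap {α : Type*} [MetricSpace α] {P : Set α} (hP : P.Finite)
    (hP' : P.Nontrivial) : ∃ c s r, IsValidGap P c s r := by
  obtain ⟨c, hc, q, hq, hcq⟩ := hP'
  obtain ⟨u, ⟨hu, huc⟩, hmin⟩ :=
    Set.exists_min_image (P \ {c}) (dist · c) hP.sdiff ⟨q, hq, hcq.symm⟩
  refine ⟨c, 0, dist u c, le_rfl, dist_pos.2 huc, fun p hp => ?_, ⟨c, hc, (dist_self c).le⟩,
    u, hu, le_rfl⟩
  rcases eq_or_ne p c with rfl | hpc
  · exact .inl (dist_self p).le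
  · exact .inr (hmin p ⟨hp, hpc⟩)

theorem axisSquare_eq_closedBall (c : ℝ × ℝ) (r : ℝ) :
    axisSquare c r = Metric.closedBall c r := by
  ext q
  simp only [axisSquare, Set.mem_ofPred_eq, Metric.mem_closedBall, Prod.dist_eq, Real.dist_eq,
    max_le_iff]

theorem SquareAnnulus.interior_region (A : SquareAnnulus) :
    interior A.region =
      {q | A.innerRadius < dist q A.center ∧ dist q A.center < A.outerRadius} := by
  have hregion : A.region = A.outerSquare ∩ A.innerSquareᶜ := rfl
  rw [hregion, interior_inter, interior_compl, outerSquare, innerSquare,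
    axisSquare_eq_closedBall, axisSquare_eq_closedBall, interior_closedBall',
    Metric.isClosed_closedBall.closure_eq]
  ext q
  simp [and_comm]

theorem SquareAnnulus.isEmptyOf_and_isValidFor_iff (A : SquareAnnulus) (P : Set (ℝ × ℝ))
    (h : 0 < A.width) :
    A.IsEmptyOf P ∧ A.IsValidFor P ↔ IsValidGap P A.center A.innerRadius A.outerRadius := by
  have hlt : A.innerRadius < A.outerRadius := sub_pos.1 h
  have hempty : A.IsEmptyOf P ↔
      ∀ p ∈ P, dist p A.center ≤ A.innerRadius ∨ A.outerRadius ≤ dist p A.center := by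
    rw [IsEmptyOf, interior_region, Set.disjoint_right]
    simp only [Set.mem_ofPred_eq, not_and_or, not_lt]
  have hmem (p) : p ∈ A.innerSquare ↔ dist p A.center ≤ A.innerRadius := by
    rw [innerSquare, axisSquare_eq_closedBall, Metric.mem_closedBall]
  rw [hempty]
  constructor
  · rintro ⟨he, ⟨q, hq, hq'⟩, p, hp, hp'⟩
    exact ⟨A.inner_nonneg, hlt, he, ⟨p, hp, (hmem p).1 hp'⟩, q, hq,
      (he q hq).resolve_left fun hi => hq' ⟨hq, (hmem q).2 hi⟩⟩
  · rintro ⟨-, -, he, ⟨p, hp, hp'⟩, q, hq, hq'⟩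
    exact ⟨he, ⟨q, hq, fun hi => (hlt.trans_le hq').not_ge ((hmem q).1 hi.2)⟩, p, hp,
      (hmem p).2 hp'⟩

/-! ### Annuli that span a strip -/

/-- The distance from `x` to the nearer end of the interval from `a` to `b`, negative outside. -/
def margin (a b x : ℝ) : ℝ := min (x - a) (b - x)

theorem le_margin_iff {a b x w : ℝ} : w ≤ margin a b x ↔ w ≤ x - a ∧ w ≤ b - x := le_min_iff

theorem margin_pos_iff {a b x : ℝ} : 0 < margin a b x ↔ x ∈ Set.Ioo a b := by
  simp only [margin, lt_min_iff, sub_pos, Set.mem_Ioo]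

theorem abs_sub_midpoint (a b x : ℝ) : |x - (a + b) / 2| = (b - a) / 2 - margin a b x := by
  grind [margin]

/-- The outer square of the gap spans the strip `a < x < b`: it has its sides on the two lines that
bound the strip. The gap has width `w` and its center lies at height `t`. -/
def IsSpanningGap (P : Set (ℝ × ℝ)) (a b w t : ℝ) : Prop :=
  IsValidGap P ((a + b) / 2, t) ((b - a) / 2 - w) ((b - a) / 2)

/-- The abscissae of the points, and two sentinels `∓ M` in place of points far away. -/
def abscissae (P : Set (ℝ × ℝ)) (M : ℝ) : Set ℝ := {-M, M} ∪ Prod.fst '' P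

/-- The widths of the valid empty annuli that span a strip between two abscissae. -/
def spanningWidths (P : Set (ℝ × ℝ)) (M : ℝ) : Set ℝ :=
  {w | ∃ a ∈ abscissae P M, ∃ b ∈ abscissae P M,
    a < b ∧ b - a < 2 * M ∧ ∃ t, IsSpanningGap P a b w t}

section

variable {P : Set (ℝ × ℝ)} {a b c d s r w t M : ℝ}

theorem isSpanningGap_iff (hside : ∃ p ∈ P, p.1 = a ∨ p.1 = b) :
    IsSpanningGap P a b w t ↔ 0 < w ∧
      (∃ p ∈ P, w ≤ margin a b p.1 ∧ |p.2 - t| ≤ (b - a) / 2 - w) ∧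
      ∀ p ∈ P, p.1 ∈ Set.Ioo a b →
        (w ≤ margin a b p.1 ∧ |p.2 - t| ≤ (b - a) / 2 - w) ∨ (b - a) / 2 ≤ |p.2 - t| := by
  have hle (p : ℝ × ℝ) : dist p ((a + b) / 2, t) ≤ (b - a) / 2 - w ↔
      w ≤ margin a b p.1 ∧ |p.2 - t| ≤ (b - a) / 2 - w := by
    rw [Prod.dist_eq, max_le_iff, Real.dist_eq, Real.dist_eq, abs_sub_midpoint,
      sub_le_sub_iff_left]
  have hge (p : ℝ × ℝ) : (b - a) / 2 ≤ dist p ((a + b) / 2, t) ↔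
      p.1 ∉ Set.Ioo a b ∨ (b - a) / 2 ≤ |p.2 - t| := by
    rw [Prod.dist_eq, le_max_iff, Real.dist_eq, Real.dist_eq, abs_sub_midpoint, ← margin_pos_iff,
      not_lt, le_sub_self_iff]
  constructor
  · rintro ⟨-, hw, hdist, hnear, -⟩
    simp only [hle, hge] at hdist hnear
    exact ⟨by linarith, hnear, fun p hp hin => (hdist p hp).imp_right (·.resolve_left (· hin))⟩
  · rintro ⟨hw, ⟨q, hq, hqw, hqt⟩, hdist⟩
    refine ⟨(abs_nonneg _).trans hqt, by linarith, fun p hp => ?_, ⟨q, hq, (hle q).2 ⟨hqw, hqt⟩⟩,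
      ?_⟩
    · rw [hle, hge]
      by_cases hin : p.1 ∈ Set.Ioo a b
      · exact (hdist p hp hin).imp_right .inr
      · exact .inr (.inl hin)
    · obtain ⟨p, hp, hpab⟩ := hside
      exact ⟨p, hp, (hge p).2 (.inl (by rcases hpab with rfl | rfl <;> simp))⟩

theorem exists_fst_eq_of_mem_abscissae (ha : a ∈ abscissae P M) (hb : b ∈ abscissae P M)
    (hab : a < b) (hM : b - a < 2 * M) : ∃ p ∈ P, p.1 = a ∨ p.1 = b := by
  rcases ha with (rfl | rfl) | ⟨p, hp, rfl⟩
  · rcases hb with (rfl | rfl) | ⟨p, hp, rfl⟩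
    · exact absurd hab (lt_irrefl _)
    · linarith
    · exact ⟨p, hp, .inr rfl⟩
  · rcases hb with (rfl | rfl) | ⟨p, hp, rfl⟩
    · linarith
    · exact absurd hab (lt_irrefl _)
    · exact ⟨p, hp, .inr rfl⟩
  · exact ⟨p, hp, .inl rfl⟩

/-- In the open rectangle with sides `a < x < b` and `c < y < d`, the points of `P` leave room for a
frame of width `w`: along the four sides, and also inside every square of side length `b - a` or
`d - c` that contains them suitably centered. -/
structure HasRoom (P : Set (ℝ × ℝ)) (a b c d w : ℝ) : Prop where
  nonempty : (P ∩ Set.Ioo a b ×ˢ Set.Ioo c d).Nonempty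
  le_margin_fst : ∀ p ∈ P ∩ Set.Ioo a b ×ˢ Set.Ioo c d, w ≤ margin a b p.1
  le_margin_snd : ∀ p ∈ P ∩ Set.Ioo a b ×ˢ Set.Ioo c d, w ≤ margin c d p.2
  fst_sub_fst_le : ∀ p ∈ P ∩ Set.Ioo a b ×ˢ Set.Ioo c d, ∀ q ∈ P ∩ Set.Ioo a b ×ˢ Set.Ioo c d,
    p.1 - q.1 ≤ d - c - 2 * w
  snd_sub_snd_le : ∀ p ∈ P ∩ Set.Ioo a b ×ˢ Set.Ioo c d, ∀ q ∈ P ∩ Set.Ioo a b ×ˢ Set.Ioo c d,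
    p.2 - q.2 ≤ b - a - 2 * w

theorem HasRoom.swap (h : HasRoom P a b c d w) : HasRoom (Prod.swap '' P) c d a b w := by
  have hmem : ∀ q ∈ Prod.swap '' P ∩ Set.Ioo c d ×ˢ Set.Ioo a b,
      q.swap ∈ P ∩ Set.Ioo a b ×ˢ Set.Ioo c d := by
    rintro _ ⟨⟨p, hp, rfl⟩, hpy, hpx⟩
    exact ⟨hp, hpx, hpy⟩
  obtain ⟨p, hp, hpx, hpy⟩ := h.nonempty
  exact ⟨⟨p.swap, ⟨p, hp, rfl⟩, hpy, hpx⟩, fun q hq => h.le_margin_snd _ (hmem q hq),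
    fun q hq => h.le_margin_fst _ (hmem q hq),
    fun q hq q' hq' => h.snd_sub_snd_le _ (hmem q hq) _ (hmem q' hq'),
    fun q hq q' hq' => h.fst_sub_fst_le _ (hmem q hq) _ (hmem q' hq')⟩

/-- Move the square as far down as the rectangle and the highest point in it allow. -/
theorem HasRoom.exists_isSpanningGap (h : HasRoom P a b c d w) (hP : P.Finite) (hw : 0 < w)
    (hle : b - a ≤ d - c) (hside : ∃ p ∈ P, p.1 = a ∨ p.1 = b) :
    ∃ t, IsSpanningGap P a b w t := by
  obtain ⟨u, hu, humax⟩ := Set.exists_max_image _ Prod.snd (hP.inter_of_left _) h.nonempty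
  set t := max (c + (b - a) / 2) (u.2 - (b - a) / 2 + w)
  have htop := le_margin_iff.1 (h.le_margin_snd u hu)
  have ht : t ≤ d - (b - a) / 2 := max_le (by linarith) (by linarith)
  have ht₁ : c + (b - a) / 2 ≤ t := le_max_left _ _
  have ht₂ : u.2 - (b - a) / 2 + w ≤ t := le_max_right _ _
  have hinner : ∀ p ∈ P ∩ Set.Ioo a b ×ˢ Set.Ioo c d, |p.2 - t| ≤ (b - a) / 2 - w := by
    intro p hp
    have hpt : t ≤ p.2 + (b - a) / 2 - w :=
      max_le (by linarith [le_margin_iff.1 (h.le_margin_snd p hp)])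
        (by linarith [h.snd_sub_snd_le u hu p hp])
    rw [abs_le]
    constructor <;> linarith [humax p hp]
  refine ⟨t, (isSpanningGap_iff hside).2 ⟨hw, ⟨u, hu.1, h.le_margin_fst u hu, hinner u hu⟩,
    fun p hp hpx => ?_⟩⟩
  by_cases hpy : p.2 ∈ Set.Ioo c d
  · exact .inl ⟨h.le_margin_fst p ⟨hp, hpx, hpy⟩, hinner p ⟨hp, hpx, hpy⟩⟩
  · right
    rw [Set.mem_Ioo, not_and_or, not_lt, not_lt] at hpy
    rw [le_abs']
    exact hpy.imp (fun _ => by linarith) fun _ => by linarith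

theorem exists_lower_side {α : Type*} {P : Set α} (hP : P.Finite) (f : α → ℝ) (Z : α → Prop)
    (y M : ℝ) :
    ∃ a, (a = -M ∨ a ∈ f '' P ∧ a ≤ y) ∧ ∀ p ∈ P, Z p → a < f p → y < f p := by
  by_cases hne : {p ∈ P | Z p ∧ f p ≤ y}.Nonempty
  · obtain ⟨u, ⟨hu, -, huy⟩, hmax⟩ :=
      Set.exists_max_image _ f (hP.subset (Set.sep_subset ..)) hne
    refine ⟨f u, .inr ⟨⟨u, hu, rfl⟩, huy⟩, fun p hp hZ hlt => ?_⟩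
    by_contra! hpy
    exact (hmax p ⟨hp, hZ, hpy⟩).not_gt hlt
  · refine ⟨-M, .inl rfl, fun p hp hZ _ => ?_⟩
    by_contra! hpy
    exact hne ⟨p, hp, hZ, hpy⟩

/-- If possible, the interval from `x - r` to `x + r` is extended to the nearest values of `f` at
points that satisfy `Z`, and otherwise to the sentinels. -/
theorem exists_sides {α : Type*} {P : Set α} (hP : P.Finite) (f : α → ℝ) (Z : α → Prop)
    {x s r K M : ℝ} (hK : 0 ≤ K) (hf : ∀ p ∈ P, |f p| ≤ K) (hr : r - s ≤ 2 * K) (hM : 8 * K < M) :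
    ∃ a ∈ {-M, M} ∪ f '' P, ∃ b ∈ {-M, M} ∪ f '' P, -M ≤ a ∧ b ≤ M ∧
      (∀ p ∈ P, Z p → f p ∈ Set.Ioo a b → |f p - x| < r) ∧
      (∀ p ∈ P, |f p - x| ≤ s → r - s ≤ margin a b (f p)) ∧
      min s K ≤ (b - a) / 2 - (r - s) := by
  obtain ⟨a, ha, ha'⟩ := exists_lower_side hP f Z (x - r) M
  obtain ⟨b, hb, hb'⟩ := exists_lower_side hP (-f ·) Z (-(x + r)) M
  have hf' (p) (hp : p ∈ P) := abs_le.1 (hf p hp)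
  have hA : a = -M ∨ a ≤ x - r ∧ -K ≤ a ∧ a ≤ K := by
    rcases ha with ha | ⟨⟨p, hp, rfl⟩, hle⟩
    · exact .inl ha
    · exact .inr ⟨hle, hf' p hp⟩
  have hB : b = -M ∨ b ≤ -(x + r) ∧ -K ≤ b ∧ b ≤ K := by
    rcases hb with hb | ⟨⟨p, hp, rfl⟩, hle⟩
    · exact .inl hb
    · exact .inr ⟨hle, by linarith [hf' p hp], by linarith [hf' p hp]⟩
  refine ⟨a, ?_, -b, ?_, ?_, ?_, fun p hp hZ hpab => ?_, fun p hp hps => ?_, ?_⟩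
  · exact ha.elim (fun h => .inl (.inl h)) fun h => .inr h.1
  · rcases hb with rfl | ⟨⟨p, hp, rfl⟩, -⟩
    · exact .inl (.inr (neg_neg M))
    · exact .inr ⟨p, hp, (neg_neg _).symm⟩
  · rcases hA with hA | hA <;> linarith
  · rcases hB with hB | hB <;> linarith
  · rw [abs_lt]
    constructor
    · linarith [ha' p hp hZ hpab.1]
    · linarith [hb' p hp hZ (lt_neg.1 hpab.2)]
  · rw [le_margin_iff]
    have := hf' p hp
    rw [abs_le] at hps
    constructor
    · rcases hA with hA | hA <;> linarith
    · rcases hB with hB | hB <;> linarith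
  · have := min_le_left s K
    have := min_le_right s K
    rcases hA with hA | hA <;> rcases hB with hB | hB <;> linarith

theorem IsValidGap.sub_le {c : ℝ × ℝ} {K : ℝ} (h : IsValidGap P c s r) (hK : ∀ p ∈ P, ‖p‖ ≤ K) :
    r - s ≤ 2 * K := by
  obtain ⟨p, hp, hps⟩ := h.exists_dist_le
  obtain ⟨q, hq, hqr⟩ := h.exists_le_dist
  linarith [dist_triangle q p c, dist_le_norm_add_norm q p, hK p hp, hK q hq]

theorem sub_le_two_mul_min {x v v' K : ℝ} (hv : |v - x| ≤ s) (hv' : |v' - x| ≤ s) (hvK : |v| ≤ K)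
    (hvK' : |v'| ≤ K) : v - v' ≤ 2 * min s K := by
  rw [abs_le] at hv hv' hvK hvK'
  have : (v - v') / 2 ≤ min s K := le_min (by linarith) (by linarith)
  linarith

theorem IsValidGap.exists_hasRoom {z : ℝ × ℝ} {K : ℝ} (h : IsValidGap P z s r) (hP : P.Finite)
    (hK : ∀ p ∈ P, ‖p‖ ≤ K) (hM : 8 * K < M) :
    ∃ a ∈ abscissae P M, ∃ b ∈ abscissae P M, ∃ c ∈ abscissae (Prod.swap '' P) M,
      ∃ d ∈ abscissae (Prod.swap '' P) M, HasRoom P a b c d (r - s) ∧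
        (b - a < 2 * M ∨ d - c < 2 * M) := by
  have hs (p : ℝ × ℝ) : dist p z ≤ s ↔ |p.1 - z.1| ≤ s ∧ |p.2 - z.2| ≤ s := by
    rw [Prod.dist_eq, max_le_iff, Real.dist_eq, Real.dist_eq]
  have hfst (p) (hp : p ∈ P) : |p.1| ≤ K := (norm_fst_le p).trans (hK p hp)
  have hsnd (p) (hp : p ∈ P) : |p.2| ≤ K := (norm_snd_le p).trans (hK p hp)
  obtain ⟨u, hu, hus⟩ := h.exists_dist_le
  obtain ⟨v, hv, hvr⟩ := h.exists_le_dist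
  have hK0 : 0 ≤ K := (norm_nonneg u).trans (hK u hu)
  have hw := sub_pos.2 h.lt
  rw [hs] at hus
  obtain ⟨a, ha, b, hb, haM, hbM, hab, habs, habw⟩ := exists_sides hP Prod.fst
    (fun p => |p.2 - z.2| < r) (x := z.1) hK0 hfst (h.sub_le hK) hM
  obtain ⟨c, hc, d, hd, hcM, hdM, hcd, hcds, hcdw⟩ := exists_sides hP Prod.snd
    (fun p => p.1 ∈ Set.Ioo a b) (x := z.2) hK0 hsnd (h.sub_le hK) hM
  have hnear : ∀ p ∈ P ∩ Set.Ioo a b ×ˢ Set.Ioo c d, dist p z ≤ s := fun p ⟨hp, hpx, hpy⟩ =>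
    have hy := hcd p hp hpx hpy
    (h.dist_le_or_le p hp).resolve_right (max_lt (hab p hp hy hpx) hy).not_ge
  have hin (p) (hp : p ∈ P ∩ Set.Ioo a b ×ˢ Set.Ioo c d) := (hs p).1 (hnear p hp)
  have habscissae : abscissae (Prod.swap '' P) M = {-M, M} ∪ Prod.snd '' P := by
    simp only [abscissae, Set.image_image, Prod.fst_swap]
  refine ⟨a, ha, b, hb, c, habscissae ▸ hc, d, habscissae ▸ hd,
    ⟨⟨u, hu, margin_pos_iff.1 (hw.trans_le (habs u hu hus.1)),
      margin_pos_iff.1 (hw.trans_le (hcds u hu hus.2))⟩,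
    fun p hp => habs p hp.1 (hin p hp).1, fun p hp => hcds p hp.1 (hin p hp).2,
    fun p hp q hq => ?_, fun p hp q hq => ?_⟩, ?_⟩
  · linarith [sub_le_two_mul_min (hin p hp).1 (hin q hq).1 (hfst p hp.1) (hfst q hq.1)]
  · linarith [sub_le_two_mul_min (hin p hp).2 (hin q hq).2 (hsnd p hp.1) (hsnd q hq.1)]
  · by_contra! hnot
    have hvx := abs_le.1 (hfst v hv)
    have hvy := abs_le.1 (hsnd v hv)
    have := hnear v ⟨hv, ⟨by linarith, by linarith⟩, by linarith, by linarith⟩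
    linarith

theorem IsValidGap.sub_mem_spanningWidths {z : ℝ × ℝ} {K : ℝ} (h : IsValidGap P z s r)
    (hP : P.Finite) (hK : ∀ p ∈ P, ‖p‖ ≤ K) (hM : 8 * K < M) :
    r - s ∈ spanningWidths P M ∪ spanningWidths (Prod.swap '' P) M := by
  have key {Q : Set (ℝ × ℝ)} {a b c d : ℝ} (hQ : Q.Finite) (ha : a ∈ abscissae Q M)
      (hb : b ∈ abscissae Q M) (hroom : HasRoom Q a b c d (r - s)) (hle : b - a ≤ d - c)
      (hlt : b - a < 2 * M ∨ d - c < 2 * M) : r - s ∈ spanningWidths Q M := by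
    obtain ⟨p, -, hpx, -⟩ := hroom.nonempty
    have hab := hpx.1.trans hpx.2
    have hbM := hlt.elim id hle.trans_lt
    exact ⟨a, ha, b, hb, hab, hbM, hroom.exists_isSpanningGap hQ (sub_pos.2 h.lt) hle
      (exists_fst_eq_of_mem_abscissae ha hb hab hbM)⟩
  obtain ⟨a, ha, b, hb, c, hc, d, hd, hroom, hlt⟩ := h.exists_hasRoom hP hK hM
  rcases le_total (b - a) (d - c) with hle | hle
  · exact .inl (key hP ha hb hroom hle hlt)
  · exact .inr (key (hP.image _) hc hd hroom.swap hle hlt.symm)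

end

/-! ### Sliding a window over a sorted sequence -/

/-- The smallest of `r` and of the values of `μ` in the window from `i` to before `j`. -/
noncomputable def windowMin (μ : ℕ → ℝ) (r : ℝ) (i j : ℕ) : ℝ := (Finset.Ico i j).fold min r μ

section

variable {μ : ℕ → ℝ} {r x : ℝ} {i j s : ℕ}

theorem le_windowMin_iff : x ≤ windowMin μ r i j ↔ x ≤ r ∧ ∀ l ∈ Set.Ico i j, x ≤ μ l := by
  simp only [windowMin, Finset.le_fold_min, Finset.mem_Ico, Set.mem_Ico]

@[simp]
theorem windowMin_self : windowMin μ r i i = r := by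
  rw [windowMin, Finset.Ico_self, Finset.fold_empty]

theorem windowMin_append (his : i ≤ s) (hsj : s ≤ j) :
    windowMin μ r i j = min (windowMin μ r s j) (windowMin μ r i s) := by
  refine eq_of_forall_le_iff fun x => ?_
  simp only [le_min_iff, le_windowMin_iff, ← Set.Ico_union_Ico_eq_Ico his hsj, Set.mem_union,
    or_imp, forall_and]
  tauto

theorem windowMin_succ_right (hij : i ≤ j) :
    windowMin μ r i (j + 1) = min (windowMin μ r i j) (μ j) := by
  rw [windowMin, Nat.Ico_succ_right_eq_insert_Ico hij, Finset.fold_insert Finset.right_notMem_Ico,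
    min_comm, windowMin]

theorem windowMin_eq_min_left (hij : i < j) :
    windowMin μ r i j = min (windowMin μ r (i + 1) j) (μ i) := by
  rw [windowMin, ← Finset.insert_Ico_add_one_left_eq_Ico hij, Finset.fold_insert (by simp),
    min_comm, windowMin]

end

/-- In the strip of half-width `r` with the points at the heights `u 1, …, u k` and with the margins
`μ 1, …, μ k`, this is the condition of `isSpanningGap_iff` for the width `w` and the height `t`. -/
def IsSlot (u μ : ℕ → ℝ) (k : ℕ) (r w t : ℝ) : Prop :=
  0 < w ∧ (∃ l ∈ Set.Icc 1 k, w ≤ μ l ∧ |u l - t| ≤ r - w) ∧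
    ∀ l ∈ Set.Icc 1 k, (w ≤ μ l ∧ |u l - t| ≤ r - w) ∨ r ≤ |u l - t|

theorem isSpanningGap_iff_isSlot {P : Set (ℝ × ℝ)} {u μ : ℕ → ℝ} {k : ℕ} {a b w t : ℝ}
    (hside : ∃ p ∈ P, p.1 = a ∨ p.1 = b)
    (hstrip : (fun l => (u l, μ l)) '' Set.Icc 1 k =
      (fun p : ℝ × ℝ => (p.2, margin a b p.1)) '' {p ∈ P | p.1 ∈ Set.Ioo a b}) :
    IsSpanningGap P a b w t ↔ IsSlot u μ k ((b - a) / 2) w t := by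
  set r := (b - a) / 2
  have hforall (Q : ℝ × ℝ → Prop) : (∀ p ∈ P, p.1 ∈ Set.Ioo a b → Q (p.2, margin a b p.1)) ↔
      ∀ l ∈ Set.Icc 1 k, Q (u l, μ l) := by
    rw [← Set.forall_mem_image (p := Q) (f := fun l => (u l, μ l)), hstrip, Set.forall_mem_image]
    simp only [Set.mem_ofPred_eq, and_imp]
  have hexists (Q : ℝ × ℝ → Prop) : (∃ p ∈ P, p.1 ∈ Set.Ioo a b ∧ Q (p.2, margin a b p.1)) ↔
      ∃ l ∈ Set.Icc 1 k, Q (u l, μ l) := by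
    rw [← Set.exists_mem_image (p := Q) (f := fun l => (u l, μ l)), hstrip, Set.exists_mem_image]
    simp only [Set.mem_ofPred_eq, and_assoc]
  rw [isSpanningGap_iff hside, IsSlot,
    ← hforall fun q => (w ≤ q.2 ∧ |q.1 - t| ≤ r - w) ∨ r ≤ |q.1 - t|,
    ← hexists fun q => w ≤ q.2 ∧ |q.1 - t| ≤ r - w]
  refine and_congr_right fun hw => and_congr_left' (exists_congr fun p => and_congr_right' ?_)
  exact (and_iff_right_of_imp fun h => margin_pos_iff.1 (hw.trans_le h.1)).symm

/-- The heights of a strip of half-width `r` as the sweep needs them: `u 1, …, u k` is increasing,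
and `u 0` and `u (k + 1)` are so far away that no square of radius `r` around a height in between
contains them. -/
structure IsSweepable (u : ℕ → ℝ) (k : ℕ) (r : ℝ) : Prop where
  radius_pos : 0 < r
  monotoneOn : MonotoneOn u (Set.Icc 1 k)
  bottom_add_le : ∀ l ∈ Set.Icc 1 (k + 1), u 0 + 2 * r ≤ u l
  add_le_top : ∀ l ∈ Set.Icc 0 k, u l + 2 * r ≤ u (k + 1)

theorem IsSweepable.le {u : ℕ → ℝ} {k : ℕ} {r : ℝ} (h : IsSweepable u k r) {l l' : ℕ}
    (hl : l ≤ l') (hl' : l' ≤ k + 1) : u l ≤ u l' := by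
  have hr := h.radius_pos
  rcases hl.eq_or_lt with rfl | hlt
  · exact le_rfl
  rcases l.eq_zero_or_pos with rfl | hpos
  · linarith [h.bottom_add_le l' ⟨by omega, hl'⟩]
  rcases hl'.eq_or_lt with rfl | hlt'
  · linarith [h.add_le_top l ⟨by omega, by omega⟩]
  · exact h.monotoneOn ⟨hpos, by omega⟩ ⟨by omega, by omega⟩ hl

/-- The height between `u (i - 1) + r` and `u j - r` that is nearest to the middle of the window of
the heights `u i, …, u (j - 1)`. -/
noncomputable def slotHeight (u : ℕ → ℝ) (r : ℝ) (i j : ℕ) : ℝ :=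
  min (max ((u i + u (j - 1)) / 2) (u (i - 1) + r)) (u j - r)

/-- The greatest width of a slot whose square contains exactly the window of the heights
`u i, …, u (j - 1)`, if it is positive. -/
noncomputable def slotWidth (u μ : ℕ → ℝ) (r : ℝ) (i j : ℕ) : ℝ :=
  min (min (windowMin μ r i j) (slotHeight u r i j - u (j - 1) + r)) (u i + r - slotHeight u r i j)

section

variable {u μ : ℕ → ℝ} {k i j : ℕ} {r w t : ℝ}

theorem IsSlot.le_slotWidth (h : IsSlot u μ k r w t) (hu : IsSweepable u k r) (hi : 1 ≤ i)
    (hij : i < j) (hj : j ≤ k + 1) (hbelow : u (i - 1) ≤ t - r) (hfirst : t - r < u i)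
    (hlast : u (j - 1) < t + r) (habove : t + r ≤ u j) : w ≤ slotWidth u μ r i j := by
  have hinside : ∀ l ∈ Set.Ico i j, w ≤ μ l ∧ |u l - t| ≤ r - w := fun l hl =>
    (h.2.2 l ⟨hi.trans hl.1, by have := hl.2; omega⟩).resolve_right <| not_le.2 <| abs_lt.2
      ⟨by linarith [hu.le hl.1 (hl.2.le.trans hj)],
        by linarith [hu.le (Nat.le_sub_one_of_lt hl.2) (by omega : j - 1 ≤ k + 1)]⟩
  obtain ⟨-, hfirst'⟩ := hinside i ⟨le_rfl, hij⟩
  obtain ⟨-, hlast'⟩ := hinside (j - 1) ⟨by omega, by omega⟩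
  rw [abs_le] at hfirst' hlast'
  refine le_min (le_min (le_windowMin_iff.2 ⟨?_, fun l hl => (hinside l hl).1⟩) ?_) ?_
  · linarith
  · have : u (j - 1) - r + w ≤ slotHeight u r i j :=
      le_min (le_max_of_le_left (by linarith)) (by linarith)
    linarith
  · have : slotHeight u r i j ≤ u i + r - w :=
      min_le_of_left_le (max_le (by linarith) (by linarith))
    linarith

theorem isSlot_slotWidth (hu : IsSweepable u k r) (hi : 1 ≤ i) (hij : i < j) (hj : j ≤ k + 1)
    (hroom : u (i - 1) + 2 * r ≤ u j) (hpos : 0 < slotWidth u μ r i j) :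
    IsSlot u μ k r (slotWidth u μ r i j) (slotHeight u r i j) := by
  have hmem : slotHeight u r i j ∈ Set.Icc (u (i - 1) + r) (u j - r) :=
    ⟨le_min (le_max_right _ _) (by linarith), min_le_right _ _⟩
  obtain ⟨⟨hwindow, hlast⟩, hfirst⟩ :
      (slotWidth u μ r i j ≤ windowMin μ r i j ∧
        slotWidth u μ r i j ≤ slotHeight u r i j - u (j - 1) + r) ∧
      slotWidth u μ r i j ≤ u i + r - slotHeight u r i j := by
    rw [← le_min_iff, ← le_min_iff, slotWidth]
  have hinside : ∀ l ∈ Set.Ico i j, slotWidth u μ r i j ≤ μ l ∧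
      |u l - slotHeight u r i j| ≤ r - slotWidth u μ r i j := fun l hl =>
    ⟨(le_windowMin_iff.1 hwindow).2 l hl, abs_le.2
      ⟨by linarith [hu.le hl.1 (hl.2.le.trans hj)],
        by linarith [hu.le (Nat.le_sub_one_of_lt hl.2) (by omega : j - 1 ≤ k + 1)]⟩⟩
  refine ⟨hpos, ⟨i, ⟨hi, by omega⟩, hinside i ⟨le_rfl, hij⟩⟩, fun l hl => ?_⟩
  rcases lt_or_ge l i with hli | hli
  · right
    rw [abs_sub_comm]
    refine le_abs_self _ |>.trans' ?_
    linarith [hmem.1, hu.le (Nat.le_sub_one_of_lt hli) (by omega : i - 1 ≤ k + 1)]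
  rcases lt_or_ge l j with hlj | hlj
  · exact .inl (hinside l ⟨hli, hlj⟩)
  · right
    refine le_abs_self _ |>.trans' ?_
    linarith [hmem.2, hu.le hlj (hl.2.trans k.le_succ)]

theorem IsSlot.lt (h : IsSlot u μ k r w t) (hu : IsSweepable u k r) (hi : i ≤ k + 1)
    (hbelow : u (i - 1) ≤ t - r) (habove : t + r ≤ u j) : i < j := by
  obtain ⟨hw, ⟨l, hl, -, hlt⟩, -⟩ := h
  rw [abs_le] at hlt
  by_contra! hji
  rcases lt_or_ge l i with hli | hli
  · linarith [hu.le (Nat.le_sub_one_of_lt hli) (by omega : i - 1 ≤ k + 1)]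
  · linarith [hu.le (hji.trans hli) (hl.2.trans k.le_succ)]

/-- Every slot wider than `x` has its lower side above `u (i - 1)` and its upper side above
`u (j - 1)`, so that the window from `i` to before `j` has not passed it yet. -/
def SweptTo (u μ : ℕ → ℝ) (k : ℕ) (r : ℝ) (i j : ℕ) (x : ℝ) : Prop :=
  ∀ w t, IsSlot u μ k r w t → w ≤ x ∨ u (i - 1) ≤ t - r ∧ u (j - 1) < t + r

namespace SweptTo

variable {x y : ℝ}

theorem initial (hu : IsSweepable u k r) (x : ℝ) : SweptTo u μ k r 1 1 x := by
  rintro w t ⟨hw, ⟨l, hl, -, hlt⟩, -⟩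
  have hbottom := hu.bottom_add_le l ⟨hl.1, hl.2.trans k.le_succ⟩
  rw [abs_le] at hlt
  rw [Nat.sub_self]
  exact .inr ⟨by linarith, by linarith⟩

theorem mono (h : SweptTo u μ k r i j x) (hxy : x ≤ y) : SweptTo u μ k r i j y :=
  fun w t hslot => (h w t hslot).imp_left (·.trans hxy)

theorem le_or_lt_or_le (h : SweptTo u μ k r i j x) (hu : IsSweepable u k r) (hi : 1 ≤ i)
    (hij : i ≤ j) (hj : j ≤ k + 1) (hx : i < j → slotWidth u μ r i j ≤ x)
    (hslot : IsSlot u μ k r w t) :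
    w ≤ x ∨ (u (i - 1) ≤ t - r ∧ u (j - 1) < t + r) ∧ (u j < t + r ∨ u i ≤ t - r) := by
  refine (h w t hslot).elim .inl fun ⟨hbelow, hlast⟩ => ?_
  by_cases hside : u j < t + r ∨ u i ≤ t - r
  · exact .inr ⟨⟨hbelow, hlast⟩, hside⟩
  · rw [not_or, not_lt, not_le] at hside
    have hlt := hslot.lt hu (hij.trans hj) hbelow hside.1
    exact .inl ((hslot.le_slotWidth hu hi hlt hj hbelow hside.2 hlast hside.1).trans (hx hlt))

theorem succ_right (h : SweptTo u μ k r i j x) (hu : IsSweepable u k r) (hi : 1 ≤ i)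
    (hij : i ≤ j) (hj : j ≤ k + 1) (hx : i < j → slotWidth u μ r i j ≤ x)
    (hgrow : u j < u i + 2 * r) : SweptTo u μ k r i (j + 1) x := fun w t hslot =>
  (h.le_or_lt_or_le hu hi hij hj hx hslot).imp_right fun ⟨⟨hbelow, _⟩, hside⟩ =>
    ⟨hbelow, hside.elim id fun _ => by rw [Nat.add_sub_cancel]; linarith⟩

theorem succ_left (h : SweptTo u μ k r i j x) (hu : IsSweepable u k r) (hi : 1 ≤ i)
    (hij : i ≤ j) (hj : j ≤ k + 1) (hx : i < j → slotWidth u μ r i j ≤ x)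
    (hshrink : u i + 2 * r ≤ u j) : SweptTo u μ k r (i + 1) j x := fun w t hslot =>
  (h.le_or_lt_or_le hu hi hij hj hx hslot).imp_right fun ⟨⟨_, hlast⟩, hside⟩ =>
    ⟨hside.elim (fun _ => by rw [Nat.add_sub_cancel]; linarith) id, hlast⟩

theorem le_of_done (h : SweptTo u μ k r (k + 1) j x) (hu : IsSweepable u k r)
    (hslot : IsSlot u μ k r w t) : w ≤ x := by
  refine (h w t hslot).resolve_right fun ⟨hbelow, _⟩ => ?_
  obtain ⟨hw, ⟨l, hl, -, hlt⟩, -⟩ := hslot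
  rw [abs_le] at hlt
  rw [Nat.add_sub_cancel] at hbelow
  linarith [hu.le hl.2 k.le_succ]

end SweptTo

end

namespace RealRAM

variable {L : Limits} {m m' m₁ m₂ m₃ : Memory} {t T T₁ T₂ : ℕ}

/-! ### Reasoning about programs -/

namespace Program

/-- The word registers that a program may write. -/
def wordTargets : Program → List ℕ
  | setWord i _ => [i]
  | seq c d => c.wordTargets ++ d.wordTargets
  | cond _ c d => c.wordTargets ++ d.wordTargets
  | loop _ c => c.wordTargets
  | _ => []

/-- The real registers that a program may write. -/
def realTargets : Program → List ℕ
  | setReal i _ => [i]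
  | seq c d => c.realTargets ++ d.realTargets
  | cond _ c d => c.realTargets ++ d.realTargets
  | loop _ c => c.realTargets
  | _ => []

/-- The real arrays that a program may write. -/
def arrayTargets : Program → List ℕ
  | putReal a _ _ => [a]
  | seq c d => c.arrayTargets ++ d.arrayTargets
  | cond _ c d => c.arrayTargets ++ d.arrayTargets
  | loop _ c => c.arrayTargets
  | _ => []

/-- The memories `m` and `m'` agree on the registers and the real arrays that `c` does not write. -/
structure Frame (c : Program) (m m' : Memory) : Prop where
  wordReg : ∀ i ∉ c.wordTargets, m'.wordReg i = m.wordReg i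
  realReg : ∀ i ∉ c.realTargets, m'.realReg i = m.realReg i
  realArr : ∀ a ∉ c.arrayTargets, m'.realArr a = m.realArr a

namespace Frame

variable {c d : Program}

theorem refl (c : Program) (m : Memory) : c.Frame m m :=
  ⟨fun _ _ => rfl, fun _ _ => rfl, fun _ _ => rfl⟩

theorem trans (h : c.Frame m₁ m₂) (h' : c.Frame m₂ m₃) : c.Frame m₁ m₃ where
  wordReg i hi := (h'.wordReg i hi).trans (h.wordReg i hi)
  realReg i hi := (h'.realReg i hi).trans (h.realReg i hi)
  realArr a ha := (h'.realArr a ha).trans (h.realArr a ha)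

theorem mono (h : c.Frame m m') (hw : c.wordTargets ⊆ d.wordTargets)
    (hr : c.realTargets ⊆ d.realTargets) (ha : c.arrayTargets ⊆ d.arrayTargets) :
    d.Frame m m' where
  wordReg i hi := h.wordReg i fun hc => hi (hw hc)
  realReg i hi := h.realReg i fun hc => hi (hr hc)
  realArr a h' := h.realArr a fun hc => h' (ha hc)

end Frame

end Program

open Program

theorem Run.frame {c : Program} (h : Run L c m t m') : c.Frame m m' := by
  induction h with
  | nop | loopDone => exact .refl _ _
  | setWord m i e =>
    exact ⟨fun j hj => Function.update_of_ne (List.ne_of_not_mem_cons hj) _ _,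
      fun _ _ => rfl, fun _ _ => rfl⟩
  | setReal m i e =>
    exact ⟨fun _ _ => rfl, fun j hj => Function.update_of_ne (List.ne_of_not_mem_cons hj) _ _,
      fun _ _ => rfl⟩
  | putWord => exact ⟨fun _ _ => rfl, fun _ _ => rfl, fun _ _ => rfl⟩
  | putReal m a idx e =>
    exact ⟨fun _ _ => rfl, fun _ _ => rfl,
      fun b hb => Function.update_of_ne (List.ne_of_not_mem_cons hb) _ _⟩
  | seq c d _ _ _ _ _ _ _ hc hd =>
    exact (hc.mono (List.subset_append_left _ _) (List.subset_append_left _ _)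
      (List.subset_append_left _ _)).trans (hd.mono (List.subset_append_right _ _)
      (List.subset_append_right _ _) (List.subset_append_right _ _))
  | condTrue _ _ _ _ _ _ _ _ _ hc =>
    exact hc.mono (List.subset_append_left _ _) (List.subset_append_left _ _)
      (List.subset_append_left _ _)
  | condFalse _ _ _ _ _ _ _ _ _ hd =>
    exact hd.mono (List.subset_append_right _ _) (List.subset_append_right _ _)
      (List.subset_append_right _ _)
  | loopStep _ _ _ _ _ _ _ _ _ _ _ hc hrest =>
    exact .trans ⟨hc.wordReg, hc.realReg, hc.realArr⟩ hrest

namespace Program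

open scoped Classical in
/-- The memory after a program without loops; a loop is treated as if it did nothing, which
`Safe` rules out. -/
noncomputable def exec : Program → Memory → Memory
  | nop, m => m
  | setWord i e, m => m.setWord i (e.val m)
  | setReal i e, m => m.setReal i (e.val m)
  | putWord a idx e, m => m.putWord a (idx.val m) (e.val m)
  | putReal a idx e, m => m.putReal a (idx.val m) (e.val m)
  | seq c d, m => d.exec (c.exec m)
  | cond b c d, m => if b.Holds m then c.exec m else d.exec m
  | loop _ _, m => m

/-- The program has no loop on its way and performs only legal operations. -/
def Safe (L : Limits) : Program → Memory → Prop
  | nop, _ => True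
  | setWord _ e, m => e.Legal L m
  | setReal _ e, m => e.Legal L m
  | putWord _ idx e, m => idx.Legal L m ∧ idx.val m < L.cells ∧ e.Legal L m
  | putReal _ idx e, m => idx.Legal L m ∧ idx.val m < L.cells ∧ e.Legal L m
  | seq c d, m => c.Safe L m ∧ d.Safe L (c.exec m)
  | cond b c d, m => b.Legal L m ∧ (b.Holds m → c.Safe L m) ∧ (¬ b.Holds m → d.Safe L m)
  | loop _ _, _ => False

/-- The running time of a program without loops, on the costlier branch of each conditional. -/
def maxTime : Program → ℕ
  | nop => 1
  | setWord _ e => e.cost + 1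
  | setReal _ e => e.cost + 1
  | putWord _ idx e => idx.cost + e.cost + 1
  | putReal _ idx e => idx.cost + e.cost + 1
  | seq c d => c.maxTime + d.maxTime
  | cond b c d => b.cost + max c.maxTime d.maxTime + 1
  | loop _ _ => 0

theorem Safe.exists_run {c : Program} (h : c.Safe L m) :
    ∃ t ≤ c.maxTime, Run L c m t (c.exec m) := by
  induction c generalizing m with
  | nop => exact ⟨_, le_rfl, .nop m⟩
  | setWord i e => exact ⟨_, le_rfl, .setWord m i e h⟩
  | setReal i e => exact ⟨_, le_rfl, .setReal m i e h⟩
  | putWord a idx e => exact ⟨_, le_rfl, .putWord m a idx e h.1 h.2.1 h.2.2⟩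
  | putReal a idx e => exact ⟨_, le_rfl, .putReal m a idx e h.1 h.2.1 h.2.2⟩
  | seq c d ihc ihd =>
    obtain ⟨s, hs, hc⟩ := ihc h.1
    obtain ⟨t, ht, hd⟩ := ihd h.2
    exact ⟨s + t, add_le_add hs ht, .seq c d _ _ _ s t hc hd⟩
  | cond b c d ihc ihd =>
    by_cases hb : b.Holds m
    · obtain ⟨t, ht, hc⟩ := ihc (h.2.1 hb)
      refine ⟨b.cost + t + 1, by grind [maxTime], ?_⟩
      rw [exec, if_pos hb]
      exact .condTrue b c d m _ t h.1 hb hc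
    · obtain ⟨t, ht, hd⟩ := ihd (h.2.2 hb)
      refine ⟨b.cost + t + 1, by grind [maxTime], ?_⟩
      rw [exec, if_neg hb]
      exact .condFalse b c d m _ t h.1 hb hd
  | loop b c => exact h.elim

end Program

/-- Total correctness with a time bound: within the limits `L`, the program `c` started on `m` runs
legally and halts after at most `T` steps with a memory that satisfies `Q`. -/
def HaltsWithin (L : Limits) (c : Program) (m : Memory) (T : ℕ) (Q : Memory → Prop) : Prop :=
  ∃ t ≤ T, ∃ m', Run L c m t m' ∧ Q m'

namespace HaltsWithin

variable {b : Test} {c d : Program} {Q R : Memory → Prop}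

theorem of_exec (h : c.Safe L m) (hT : c.maxTime ≤ T) (hQ : Q (c.exec m)) :
    HaltsWithin L c m T Q :=
  let ⟨t, ht, hrun⟩ := h.exists_run
  ⟨t, ht.trans hT, _, hrun, hQ⟩

theorem mono (h : HaltsWithin L c m T₁ R) (hT : T₁ ≤ T₂)
    (hQ : ∀ m', c.Frame m m' → R m' → Q m') : HaltsWithin L c m T₂ Q :=
  let ⟨t, ht, m', hrun, hR⟩ := h
  ⟨t, ht.trans hT, m', hrun, hQ m' hrun.frame hR⟩

theorem seq (hc : HaltsWithin L c m T₁ R)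
    (hd : ∀ m', c.Frame m m' → R m' → HaltsWithin L d m' T₂ Q) :
    HaltsWithin L (.seq c d) m (T₁ + T₂) Q := by
  obtain ⟨s, hs, m', hrun, hR⟩ := hc
  obtain ⟨t, ht, m'', hrun', hQ⟩ := hd m' hrun.frame hR
  exact ⟨s + t, add_le_add hs ht, m'', .seq c d _ _ _ s t hrun hrun', hQ⟩

theorem exists_seq {Q : ℕ → Memory → Prop} (hc : HaltsWithin L c m T₁ R)
    (hd : ∀ m', c.Frame m m' → R m' → ∃ T, HaltsWithin L d m' T (Q (T₁ + T))) :
    ∃ T, HaltsWithin L (.seq c d) m T (Q T) := by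
  obtain ⟨s, hs, m', hrun, hR⟩ := hc
  obtain ⟨T, t, ht, m'', hrun', hQ⟩ := hd m' hrun.frame hR
  exact ⟨T₁ + T, s + t, add_le_add hs ht, m'', .seq c d _ _ _ s t hrun hrun', hQ⟩

theorem cond (hb : b.Legal L m) (hc : b.Holds m → HaltsWithin L c m T Q)
    (hd : ¬ b.Holds m → HaltsWithin L d m T Q) :
    HaltsWithin L (.cond b c d) m (b.cost + T + 1) Q := by
  by_cases h : b.Holds m
  · obtain ⟨t, ht, m', hrun, hQ⟩ := hc h
    exact ⟨_, by gcongr, m', .condTrue b c d m m' t hb h hrun, hQ⟩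
  · obtain ⟨t, ht, m', hrun, hQ⟩ := hd h
    exact ⟨_, by gcongr, m', .condFalse b c d m m' t hb h hrun, hQ⟩

/-- The potential `Φ` pays for the iterations: each one must lower it by at least its own running
time. -/
theorem loop (I : Memory → Prop) (Φ : Memory → ℕ) (hI : I m)
    (hb : ∀ m', (Program.loop b c).Frame m m' → I m' → b.Legal L m')
    (hc : ∀ m', (Program.loop b c).Frame m m' → I m' → b.Holds m' →
      ∃ T, HaltsWithin L c m' T fun m'' => I m'' ∧ T + b.cost + 1 + Φ m'' ≤ Φ m') :
    HaltsWithin L (.loop b c) m (Φ m + b.cost + 1) fun m' => I m' ∧ ¬ b.Holds m' := by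
  induction hN : Φ m using Nat.strong_induction_on generalizing m with
  | _ N ih =>
    by_cases h : b.Holds m
    · obtain ⟨T, s, hs, m', hrun, hI', hΦ⟩ := hc m (.refl _ m) hI h
      have hframe : (Program.loop b c).Frame m m' :=
        ⟨hrun.frame.wordReg, hrun.frame.realReg, hrun.frame.realArr⟩
      obtain ⟨t, ht, m'', hrun', hpost⟩ := ih (Φ m') (by omega) hI'
        (fun m'' hm'' => hb m'' (hframe.trans hm'')) (fun m'' hm'' => hc m'' (hframe.trans hm''))
        rfl
      exact ⟨_, by omega, m'', .loopStep b c m m' m'' s t (hb m (.refl _ m) hI) h hrun hrun',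
        hpost⟩
    · exact ⟨_, by omega, m, .loopDone b c m (hb m (.refl _ m) hI) h, hI, h⟩

end HaltsWithin

namespace Memory

variable (m : Memory) (i j k a : ℕ) (x : ℝ)

@[simp] theorem wordReg_setWord : (m.setWord i k).wordReg j = if j = i then k else m.wordReg j :=
  Function.update_apply ..

@[simp] theorem realReg_setWord : (m.setWord i k).realReg = m.realReg := rfl

@[simp] theorem realArr_setWord : (m.setWord i k).realArr = m.realArr := rfl

@[simp] theorem wordReg_setReal : (m.setReal i x).wordReg = m.wordReg := rfl

@[simp] theorem realReg_setReal :
    (m.setReal i x).realReg j = if j = i then x else m.realReg j :=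
  Function.update_apply ..

@[simp] theorem realArr_setReal : (m.setReal i x).realArr = m.realArr := rfl

@[simp] theorem wordReg_putReal : (m.putReal a i x).wordReg = m.wordReg := rfl

@[simp] theorem realReg_putReal : (m.putReal a i x).realReg = m.realReg := rfl

@[simp] theorem realArr_putReal_self :
    (m.putReal a i x).realArr a = Function.update (m.realArr a) i x :=
  Function.update_self ..

@[simp] theorem realArr_putReal_of_ne {a' : ℕ} (h : a' ≠ a) :
    (m.putReal a i x).realArr a' = m.realArr a' :=
  Function.update_of_ne h ..

@[simp] theorem setReal_realReg_self : m.setReal i (m.realReg i) = m := by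
  simp only [setReal, Function.update_eq_self]

end Memory

attribute [local simp] WordExp.val WordExp.Legal RealExp.val RealExp.Legal Test.Holds Test.Legal
  Program.exec Program.Safe Program.maxTime WordExp.cost RealExp.cost Test.cost

namespace Program

/-- Runs `c` with increasing values of the word register `i`, from its current value up to but not
including the value of `e`, which is evaluated anew before every iteration. -/
def countingLoop (i : ℕ) (e : WordExp) (c : Program) : Program :=
  .loop (.wordLt (.reg i) e) (.seq c (.setWord i (.add (.reg i) (.lit 1))))

/-- Runs `c` with the values `0`, `1`, … below that of `e` in the word register `i`. -/
def forLoop (i : ℕ) (e : WordExp) (c : Program) : Program :=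
  .seq (.setWord i (.lit 0)) (countingLoop i e c)

/-- Lowers the real register `i` to the value of `e`, unless it is smaller already. -/
def setMin (i : ℕ) (e : RealExp) : Program := .cond (.realLt e (.reg i)) (.setReal i e) .nop

/-- Raises the real register `i` to the value of `e`, unless it is larger already. -/
def setMax (i : ℕ) (e : RealExp) : Program := .cond (.realLt (.reg i) e) (.setReal i e) .nop

variable {i : ℕ} {e : RealExp}

@[simp] theorem exec_setMin :
    (setMin i e).exec m = m.setReal i (min (m.realReg i) (e.val m)) := by
  by_cases h : e.val m < m.realReg i
  · simp [setMin, h, h.le]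
  · simp [setMin, h, not_lt.mp h]

@[simp] theorem safe_setMin : (setMin i e).Safe L m ↔ e.Legal L m := by
  simpa [setMin] using fun h _ => h

@[simp] theorem exec_setMax :
    (setMax i e).exec m = m.setReal i (max (m.realReg i) (e.val m)) := by
  by_cases h : m.realReg i < e.val m
  · simp [setMax, h, h.le]
  · simp [setMax, h, not_lt.mp h]

@[simp] theorem safe_setMax : (setMax i e).Safe L m ↔ e.Legal L m := by
  simpa [setMax] using fun h _ => h

end Program

namespace HaltsWithin

variable {i N : ℕ} {e : WordExp} {c : Program} (I : ℕ → Memory → Prop)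

theorem countingLoop (hN : N + 1 < L.wordBound) (hi : i ∉ c.wordTargets)
    (he : ∀ m', (Program.countingLoop i e c).Frame m m' → e.Legal L m' ∧ e.val m' = N)
    (hle : m.wordReg i ≤ N) (hI : I (m.wordReg i) m)
    (hc : ∀ v < N, ∀ m', (Program.countingLoop i e c).Frame m m' → m'.wordReg i = v → I v m' →
      HaltsWithin L c m' T fun m'' => I (v + 1) (m''.setWord i (v + 1))) :
    HaltsWithin L (Program.countingLoop i e c) m
      ((N - m.wordReg i) * (T + e.cost + 7) + e.cost + 3) (I N) := by
  refine (HaltsWithin.loop (fun m' => I (m'.wordReg i) m' ∧ m'.wordReg i ≤ N)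
    (fun m' => (N - m'.wordReg i) * (T + e.cost + 7)) ⟨hI, hle⟩ ?_ ?_).mono ?_ ?_
  · exact fun m' hF h => ⟨by simp only [WordExp.Legal]; omega, (he m' hF).1⟩
  · rintro m' hF ⟨hI, -⟩ hlt
    have hlt' : m'.wordReg i < N := (he m' hF).2 ▸ hlt
    refine ⟨T + 4, (hc _ hlt' m' hF rfl hI).seq fun m'' hF'' hI' => ?_⟩
    have hsame : m''.wordReg i = m'.wordReg i := hF''.wordReg i hi
    refine .of_exec ?_ le_rfl ⟨?_, ?_⟩
    · simp only [Program.Safe, WordExp.Legal, WordExp.val, hsame]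
      omega
    · simpa [hsame, Nat.succ_le_iff, hlt'] using hI'
    · obtain ⟨d, hd⟩ := Nat.exists_eq_add_of_lt hlt'
      simp only [Program.exec, WordExp.val, Memory.wordReg_setWord, if_true, hsame, hd,
        Test.cost, WordExp.cost]
      rw [show m'.wordReg i + d + 1 - (m'.wordReg i + 1) = d by omega,
        show m'.wordReg i + d + 1 - m'.wordReg i = d + 1 by omega, Nat.succ_mul]
      omega
  · simp only [Test.cost, WordExp.cost]
    omega
  · rintro m' hF ⟨⟨hI, hle⟩, hnot⟩
    rw [Test.Holds, (he m' hF).2, not_lt] at hnot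
    exact le_antisymm hle hnot ▸ hI

theorem forLoop (hN : N + 1 < L.wordBound) (hi : i ∉ c.wordTargets)
    (he : ∀ m', (Program.forLoop i e c).Frame m m' → e.Legal L m' ∧ e.val m' = N)
    (h0 : I 0 (m.setWord i 0))
    (hc : ∀ v < N, ∀ m', (Program.forLoop i e c).Frame m m' → m'.wordReg i = v → I v m' →
      HaltsWithin L c m' T fun m'' => I (v + 1) (m''.setWord i (v + 1))) :
    HaltsWithin L (Program.forLoop i e c) m (N * (T + e.cost + 7) + e.cost + 5) (I N) := by
  have hinit : HaltsWithin L (.setWord i (.lit 0)) m 2 (· = m.setWord i 0) :=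
    .of_exec (Nat.zero_lt_of_lt hN) le_rfl rfl
  refine (hinit.seq (T₂ := N * (T + e.cost + 7) + e.cost + 3) ?_).mono (by omega)
    fun _ _ => id
  rintro _ hstart rfl
  have hframe {m'} (h : (Program.countingLoop i e c).Frame (m.setWord i 0) m') :
      (Program.forLoop i e c).Frame m m' :=
    (hstart.mono (List.subset_append_left _ _) (List.subset_append_left _ _)
      (List.subset_append_left _ _)).trans (h.mono (List.subset_append_right _ _)
      (List.subset_append_right _ _) (List.subset_append_right _ _))
  simpa using countingLoop I hN hi (fun m' hF => he m' (hframe hF)) (by simp) (by simpa using h0)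
    fun v hv m' hF => hc v hv m' (hframe hF)

end HaltsWithin

/-! ### The sweep of a strip -/

/- The word registers (`w`), real registers (`r`) and real arrays (`a`) of the program. The
numbers of `wSize`, `aX`, `aY` and of `rCenterX`, …, `rInner` are those of the input and output
conventions. -/
local notation "wSize" => 0
local notation "wFst" => 1
local notation "wSnd" => 2
local notation "wScan" => 3
local notation "wCount" => 4
local notation "wLo" => 5
local notation "wHi" => 6
local notation "wSplit" => 7
local notation "wCursor" => 8
local notation "rCenterX" => 0
local notation "rCenterY" => 1
local notation "rOuter" => 2
local notation "rInner" => 3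
local notation "rBest" => 4
local notation "rBound" => 5
local notation "rLeft" => 6
local notation "rRight" => 7
local notation "rRadius" => 8
local notation "rBack" => 9
local notation "rHeight" => 10
local notation "rWidth" => 11
local notation "rTemp" => 12
local notation "aX" => 0
local notation "aY" => 1
local notation "aHeight" => 2
local notation "aMargin" => 3
local notation "aFront" => 4
local infixr:60 "⨟" => Program.seq

/-- Computes the height and the width of the slot of the window. -/
def computeSlot : Program :=
  .setReal rHeight (.div (.add (.get aHeight (.reg wLo))
    (.get aHeight (.sub (.reg wHi) (.lit 1)))) (.lit 2)) ⨟
  setMax rHeight (.add (.get aHeight (.sub (.reg wLo) (.lit 1))) (.reg rRadius)) ⨟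
  setMin rHeight (.sub (.get aHeight (.reg wHi)) (.reg rRadius)) ⨟
  .setReal rWidth (.reg rBack) ⨟
  setMin rWidth (.get aFront (.reg wLo)) ⨟
  setMin rWidth (.add (.sub (.reg rHeight) (.get aHeight (.sub (.reg wHi) (.lit 1))))
    (.reg rRadius)) ⨟
  setMin rWidth (.sub (.add (.get aHeight (.reg wLo)) (.reg rRadius)) (.reg rHeight))

/-- Replaces the recorded annulus by that of the computed slot, if the latter is wider. -/
def recordSlot : Program :=
  .cond (.realLt (.reg rBest) (.reg rWidth))
    (.setReal rCenterX (.div (.add (.reg rLeft) (.reg rRight)) (.lit 2)) ⨟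
      .setReal rCenterY (.reg rHeight) ⨟
      .setReal rOuter (.reg rRadius) ⨟
      .setReal rInner (.sub (.reg rRadius) (.reg rWidth)) ⨟
      .setReal rBest (.reg rWidth))
    .nop

/-- Records the slot of the window, if that is an improvement. -/
def evalWindow : Program := computeSlot ⨟ recordSlot

/-- Stores the minima of the margins from `l` to before the end of the window for all `l` in the
window, going backwards from the end. -/
def fillFront : Program :=
  .loop (.wordLt (.reg wLo) (.reg wCursor))
    (.setWord wCursor (.sub (.reg wCursor) (.lit 1)) ⨟
      setMin rTemp (.get aMargin (.reg wCursor)) ⨟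
      .putReal aFront (.reg wCursor) (.reg rTemp))

/-- Moves the split to the end of the window. -/
def rebuildFront : Program :=
  (.setWord wSplit (.reg wHi) ⨟
    .setReal rBack (.reg rRadius) ⨟
    .putReal aFront (.reg wHi) (.reg rRadius) ⨟
    .setWord wCursor (.reg wHi) ⨟
    .setReal rTemp (.reg rRadius)) ⨟
  fillFront

/-- Adds the next point to the window. -/
def growWindow : Program :=
  setMin rBack (.get aMargin (.reg wHi)) ⨟
  .setWord wHi (.add (.reg wHi) (.lit 1))

/-- Puts at least one point of the window in front of the split. -/
def ensureFront : Program := .cond (.wordLt (.reg wLo) (.reg wSplit)) .nop rebuildFront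

/-- Removes the first point from the window. -/
def shrinkWindow : Program := ensureFront ⨟ .setWord wLo (.add (.reg wLo) (.lit 1))

/-- Adds the next point, if a square of the radius of the strip has room for it together with the
first point of the window, and otherwise removes the first point. -/
def moveWindow : Program :=
  .cond (.realLt (.get aHeight (.reg wHi))
      (.add (.get aHeight (.reg wLo)) (.mul (.lit 2) (.reg rRadius))))
    growWindow shrinkWindow

/-- Records the slot of the current window and moves the window on. -/
def sweepStep : Program := .cond (.wordLt (.reg wLo) (.reg wHi)) evalWindow .nop ⨟ moveWindow

/-- Starts the sweep with an empty window at the bottom. -/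
def initWindow : Program :=
  .setWord wLo (.lit 1) ⨟
  .setWord wHi (.lit 1) ⨟
  .setWord wSplit (.lit 1) ⨟
  .setReal rBack (.reg rRadius) ⨟
  .putReal aFront (.lit 1) (.reg rRadius)

/-- Records a widest slot of a strip by a sweep in linear time. -/
def slideWindow : Program :=
  initWindow ⨟
  .loop (.wordLt (.reg wLo) (.add (.reg wCount) (.lit 1))) sweepStep

/-- The limits suffice for arrays of `n` entries and two sentinels and for counting these. -/
structure Limits.Fits (L : Limits) (n : ℕ) : Prop where
  le_cells : n + 2 ≤ L.cells
  lt_wordBound : n + 3 < L.wordBound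

/-- The memory holds the sides and the half-width of a strip and the heights and margins of the
points in it. -/
structure HoldsStrip (a b : ℝ) (k : ℕ) (u μ : ℕ → ℝ) (m : Memory) : Prop where
  left : m.realReg rLeft = a
  right : m.realReg rRight = b
  radius : m.realReg rRadius = (b - a) / 2
  count : m.wordReg wCount = k
  heights : m.realArr aHeight = u
  margins : m.realArr aMargin = μ

/-- The sequences `u 1, …, u k` and `μ 1, …, μ k` list the heights and the margins of the points of
`P` strictly between the verticals at `a` and `b`, by increasing height. -/
structure ListsStrip (P : Set (ℝ × ℝ)) (a b : ℝ) (k : ℕ) (u μ : ℕ → ℝ) : Prop where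
  image_eq : (fun l => (u l, μ l)) '' Set.Icc 1 k =
    (fun p : ℝ × ℝ => (p.2, margin a b p.1)) '' {p ∈ P | p.1 ∈ Set.Ioo a b}
  monotoneOn : MonotoneOn u (Set.Icc 1 k)

/-- In addition `P` touches one of the verticals at `a` and `b`, and `u 0` and `u (k + 1)` are
sentinels. -/
structure IsStrip (P : Set (ℝ × ℝ)) (a b : ℝ) (k : ℕ) (u μ : ℕ → ℝ) : Prop
    extends ListsStrip P a b k u μ where
  side : ∃ p ∈ P, p.1 = a ∨ p.1 = b
  sweepable : IsSweepable u k ((b - a) / 2)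

/-- The output registers `R 0, …, R 3` hold a valid empty annulus of width `R 4`, where `R 4 = 0`
stands for none. -/
structure IsRecord (P : Set (ℝ × ℝ)) (R : ℕ → ℝ) : Prop where
  nonneg : 0 ≤ R rBest
  isValidGap : 0 < R rBest → IsValidGap P (R rCenterX, R rCenterY) (R rInner) (R rOuter)
  sub_eq : 0 < R rBest → R rOuter - R rInner = R rBest

/-- The state of the sweep. The window `[lo, hi)` is a queue made of two stacks: the minima of the
margins from `l` to before the split are kept for all `l` in front of it, while behind it only the
total minimum is needed. -/
structure SweepState (P : Set (ℝ × ℝ)) (r : ℝ) (k : ℕ) (u μ : ℕ → ℝ) (m : Memory) : Prop where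
  isRecord : IsRecord P m.realReg
  one_le_lo : 1 ≤ m.wordReg wLo
  lo_le_split : m.wordReg wLo ≤ m.wordReg wSplit
  split_le_hi : m.wordReg wSplit ≤ m.wordReg wHi
  hi_le : m.wordReg wHi ≤ k + 1
  front : ∀ l ∈ Set.Icc (m.wordReg wLo) (m.wordReg wSplit),
    m.realArr aFront l = windowMin μ r l (m.wordReg wSplit)
  back : m.realReg rBack = windowMin μ r (m.wordReg wSplit) (m.wordReg wHi)
  room : u (m.wordReg wLo - 1) + 2 * r ≤ u (m.wordReg wHi)
  sweptTo : SweptTo u μ k r (m.wordReg wLo) (m.wordReg wHi) (m.realReg rBest)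

/-- Bounds the remaining time of the sweep. Its last summand pays for rebuilding the front, which
moves the split to the end of the window. -/
def sweepPotential (k : ℕ) (m : Memory) : ℕ :=
  300 * (k + 1 - m.wordReg wLo) + 300 * (k + 1 - m.wordReg wHi) + 20 * (k + 1 - m.wordReg wSplit)

/-- From `m` to `m'` the recorded width has not decreased, and it has reached all widths in `S`. -/
structure Improves (P : Set (ℝ × ℝ)) (S : Set ℝ) (m m' : Memory) : Prop where
  isRecord : IsRecord P m'.realReg
  best_le : m.realReg rBest ≤ m'.realReg rBest
  mem_upperBounds : m'.realReg rBest ∈ upperBounds S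

section

variable {P : Set (ℝ × ℝ)} {a b r : ℝ} {k n : ℕ} {u μ : ℕ → ℝ}

theorem Limits.Fits.mono (h : L.Fits n) (hk : k ≤ n) : L.Fits k :=
  ⟨by have := h.le_cells; omega, by have := h.lt_wordBound; omega⟩

theorem HoldsStrip.of_frame {c : Program} (h : HoldsStrip a b k u μ m) (hF : c.Frame m m')
    (hw : wCount ∉ c.wordTargets := by decide)
    (hr : ∀ i ∈ [rLeft, rRight, rRadius], i ∉ c.realTargets := by decide)
    (ha : ∀ i ∈ [aHeight, aMargin], i ∉ c.arrayTargets := by decide) :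
    HoldsStrip a b k u μ m' where
  left := by rw [hF.realReg _ (hr _ (by simp)), h.left]
  right := by rw [hF.realReg _ (hr _ (by simp)), h.right]
  radius := by rw [hF.realReg _ (hr _ (by simp)), h.radius]
  count := by rw [hF.wordReg _ hw, h.count]
  heights := by rw [hF.realArr _ (ha _ (by simp)), h.heights]
  margins := by rw [hF.realArr _ (ha _ (by simp)), h.margins]

theorem computeSlot_spec (hL : L.Fits k) (hm : HoldsStrip a b k u μ m)
    (hS : SweepState P ((b - a) / 2) k u μ m) :
    HaltsWithin L computeSlot m 120 fun m' =>
      m'.realReg rHeight = slotHeight u ((b - a) / 2) (m.wordReg wLo) (m.wordReg wHi) ∧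
      m'.realReg rWidth = slotWidth u μ ((b - a) / 2) (m.wordReg wLo) (m.wordReg wHi) := by
  have ⟨hcells, hwords⟩ := hL
  have ⟨_, hlo, hls, hsh, hhi, hfront, hback, _, _⟩ := hS
  have hmin : windowMin μ ((b - a) / 2) (m.wordReg wLo) (m.wordReg wHi) =
      min (m.realReg rBack) (m.realArr aFront (m.wordReg wLo)) := by
    rw [windowMin_append hls hsh, hback, hfront _ ⟨le_rfl, hls⟩]
  refine .of_exec ?_ (by decide) ?_
  · simp [computeSlot]
    omega
  · simp [computeSlot, slotWidth, slotHeight, hmin, hm.heights, hm.radius]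

theorem recordSlot_spec (hm : HoldsStrip a b k u μ m) (hR : IsRecord P m.realReg)
    (hslot : 0 < m.realReg rWidth → IsSpanningGap P a b (m.realReg rWidth) (m.realReg rHeight)) :
    HaltsWithin L recordSlot m 30 fun m' => IsRecord P m'.realReg ∧
      m.realReg rBest ≤ m'.realReg rBest ∧ m.realReg rWidth ≤ m'.realReg rBest := by
  refine .of_exec (by simp [recordSlot]) (by decide) ?_
  by_cases hlt : m.realReg rBest < m.realReg rWidth
  · have hgap := hslot (hR.nonneg.trans_lt hlt)
    rw [IsSpanningGap] at hgap
    refine ⟨⟨?_, fun _ => ?_, fun _ => ?_⟩, ?_, ?_⟩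
    · simp [recordSlot, hlt, hR.nonneg.trans hlt.le]
    · simpa [recordSlot, hlt, hm.left, hm.right, hm.radius] using hgap
    · simp [recordSlot, hlt]
    · simp [recordSlot, hlt, hlt.le]
    · simp [recordSlot, hlt]
  · rw [recordSlot, exec, if_neg (by simpa using hlt)]
    exact ⟨hR, le_rfl, not_lt.1 hlt⟩

theorem IsRecord.congr {R R' : ℕ → ℝ} (h : IsRecord P R) (hR : ∀ i ≤ 4, R' i = R i) :
    IsRecord P R' := by
  obtain ⟨h0, h1, h2⟩ := h
  constructor <;> simpa [hR]

theorem SweepState.of_frame {c : Program} (hS : SweepState P r k u μ m) (hF : c.Frame m m')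
    (hR : IsRecord P m'.realReg) (hbest : m.realReg rBest ≤ m'.realReg rBest)
    (hw : ∀ i ∈ [wLo, wHi, wSplit], i ∉ c.wordTargets := by decide)
    (hr : rBack ∉ c.realTargets := by decide) (ha : aFront ∉ c.arrayTargets := by decide) :
    SweepState P r k u μ m' := by
  have hlo : m'.wordReg wLo = m.wordReg wLo := hF.wordReg _ (hw _ (by simp))
  have hhi : m'.wordReg wHi = m.wordReg wHi := hF.wordReg _ (hw _ (by simp))
  have hsplit : m'.wordReg wSplit = m.wordReg wSplit := hF.wordReg _ (hw _ (by simp))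
  refine ⟨hR, ?_, ?_, ?_, ?_, ?_, ?_, ?_, ?_⟩ <;>
    simp only [hlo, hhi, hsplit, hF.realReg _ hr, hF.realArr _ ha]
  exacts [hS.one_le_lo, hS.lo_le_split, hS.split_le_hi, hS.hi_le, hS.front, hS.back, hS.room,
    hS.sweptTo.mono hbest]

theorem evalWindow_spec (hL : L.Fits k) (hP : IsStrip P a b k u μ) (hm : HoldsStrip a b k u μ m)
    (hS : SweepState P ((b - a) / 2) k u μ m) (hlt : m.wordReg wLo < m.wordReg wHi) :
    HaltsWithin L evalWindow m 150 fun m' => SweepState P ((b - a) / 2) k u μ m' ∧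
      m.realReg rBest ≤ m'.realReg rBest ∧
      slotWidth u μ ((b - a) / 2) (m.wordReg wLo) (m.wordReg wHi) ≤ m'.realReg rBest := by
  refine ((computeSlot_spec hL hm hS).seq (T₂ := 30)
    (Q := fun m' => IsRecord P m'.realReg ∧ m.realReg rBest ≤ m'.realReg rBest ∧
      slotWidth u μ ((b - a) / 2) (m.wordReg wLo) (m.wordReg wHi) ≤ m'.realReg rBest) ?_).mono
    le_rfl fun m' hF ⟨hR, hbest, hle⟩ => ⟨hS.of_frame hF hR hbest, hbest, hle⟩
  rintro m₁ hF₁ ⟨hheight, hwidth⟩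
  have hkeep : ∀ i ≤ 4, m₁.realReg i = m.realReg i := fun i hi =>
    hF₁.realReg i (by decide +revert)
  rw [← hwidth, ← hkeep _ le_rfl]
  refine recordSlot_spec (hm.of_frame hF₁) (hS.isRecord.congr hkeep) ?_
  rw [hheight, hwidth, isSpanningGap_iff_isSlot hP.side hP.image_eq]
  exact fun hpos => isSlot_slotWidth hP.sweepable hS.one_le_lo hlt hS.hi_le hS.room hpos

theorem fillFront_spec {i j : ℕ} (hL : L.Fits k) (hm : HoldsStrip a b k u μ m)
    (hi : m.wordReg wLo = i) (hij : i ≤ j) (hj : j ≤ k + 1) (hcursor : m.wordReg wCursor = j)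
    (htemp : m.realReg rTemp = r) (hfront : m.realArr aFront j = r) :
    HaltsWithin L fillFront m (20 * (j - i) + 4) fun m' =>
      ∀ l ∈ Set.Icc i j, m'.realArr aFront l = windowMin μ r l j := by
  have ⟨hcells, hwords⟩ := hL
  refine (HaltsWithin.loop (fun m' => m'.wordReg wCursor ∈ Set.Icc i j ∧
      m'.realReg rTemp = windowMin μ r (m'.wordReg wCursor) j ∧
      ∀ l ∈ Set.Icc (m'.wordReg wCursor) j, m'.realArr aFront l = windowMin μ r l j)
    (fun m' => 20 * (m'.wordReg wCursor - i)) ?_ ?_ ?_).mono ?_ ?_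
  · simp only [hcursor, htemp, windowMin_self, Set.Icc_self, Set.mem_singleton_iff, forall_eq,
      hfront, Set.right_mem_Icc, hij, and_self]
  · rintro m' hF ⟨⟨-, hle⟩, -⟩
    have : m'.wordReg wLo = i := (hF.wordReg _ (by decide)).trans hi
    simp
    omega
  · rintro m' hF ⟨⟨-, hle⟩, htemp', hfront'⟩ hlt
    have hi' : m'.wordReg wLo = i := (hF.wordReg _ (by decide)).trans hi
    have hμ : m'.realArr aMargin = μ := (hF.realArr _ (by decide)).trans hm.margins
    simp only [Test.Holds, WordExp.val, hi'] at hlt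
    have hmin : windowMin μ r (m'.wordReg wCursor - 1) j =
        min (windowMin μ r (m'.wordReg wCursor) j) (μ (m'.wordReg wCursor - 1)) := by
      rw [windowMin_eq_min_left (by omega), Nat.sub_add_cancel (by omega)]
    refine ⟨15, .of_exec ?_ (by decide) ⟨⟨?_, ?_, fun l hl => ?_⟩, ?_⟩⟩
    · simp
      omega
    · simp
      omega
    · simp [htemp', hμ, hmin]
    · rcases eq_or_ne l (m'.wordReg wCursor - 1) with rfl | hne
      · simp [htemp', hμ, hmin]
      · have hl' : m'.wordReg wCursor - 1 ≤ l := by simpa using hl.1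
        simpa [hne] using hfront' l ⟨by omega, hl.2⟩
    · simp
      omega
  · simp [hcursor]
  · rintro m' hF ⟨⟨⟨hge, -⟩, -, hfront'⟩, hnot⟩
    simp only [Test.Holds, WordExp.val, (hF.wordReg wLo (by decide)).trans hi, not_lt] at hnot
    rwa [← le_antisymm hnot hge]

theorem rebuildFront_spec (hL : L.Fits k) (hm : HoldsStrip a b k u μ m)
    (hS : SweepState P ((b - a) / 2) k u μ m) :
    HaltsWithin L rebuildFront m (20 * (m.wordReg wHi - m.wordReg wLo) + 20) fun m' =>
      SweepState P ((b - a) / 2) k u μ m' ∧ m'.wordReg wSplit = m.wordReg wHi := by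
  have ⟨hcells, hwords⟩ := hL
  have hhi := hS.hi_le
  have hlohi := hS.lo_le_split.trans hS.split_le_hi
  set r := (b - a) / 2
  have hinit : HaltsWithin L (.setWord wSplit (.reg wHi) ⨟ .setReal rBack (.reg rRadius) ⨟
      .putReal aFront (.reg wHi) (.reg rRadius) ⨟ .setWord wCursor (.reg wHi) ⨟
      .setReal rTemp (.reg rRadius)) m 16 fun m' =>
      m'.wordReg wSplit = m.wordReg wHi ∧ m'.wordReg wCursor = m.wordReg wHi ∧
      m'.realReg rBack = r ∧ m'.realReg rTemp = r ∧
      m'.realArr aFront (m.wordReg wHi) = r := by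
    refine .of_exec ?_ (by decide) ?_
    · simp
      omega
    · simp [hm.radius, r]
  refine ((hinit.seq (T₂ := 20 * (m.wordReg wHi - m.wordReg wLo) + 4)
    (Q := fun m' => m'.wordReg wSplit = m.wordReg wHi ∧ m'.realReg rBack = r ∧
      ∀ l ∈ Set.Icc (m.wordReg wLo) (m.wordReg wHi),
        m'.realArr aFront l = windowMin μ r l (m.wordReg wHi)) ?_)).mono (by omega) ?_
  · rintro m₁ hF₁ ⟨hsplit, hcursor, hback, htemp, hfront⟩
    refine (fillFront_spec hL (hm.of_frame hF₁) (hF₁.wordReg _ (by decide)) hlohi hhi hcursor htemp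
      hfront).mono le_rfl fun m₂ hF₂ hfront₂ => ⟨?_, ?_, hfront₂⟩
    · rw [hF₂.wordReg _ (by decide), hsplit]
    · rw [hF₂.realReg _ (by decide), hback]
  · rintro m' hF ⟨hsplit, hback, hfront⟩
    refine ⟨⟨hS.isRecord.congr fun i hi => hF.realReg i (by decide +revert), ?_, ?_, ?_, ?_, ?_, ?_,
      ?_, ?_⟩, hsplit⟩ <;>
      simp only [hsplit, hback, hF.wordReg wLo (by decide), hF.wordReg wHi (by decide),
        hF.realReg rBest (by decide)]
    exacts [hS.one_le_lo, hlohi, le_rfl, hhi, hfront, windowMin_self.symm, hS.room, hS.sweptTo]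

theorem growWindow_spec (hL : L.Fits k) (hu : IsSweepable u k ((b - a) / 2))
    (hm : HoldsStrip a b k u μ m) (hS : SweepState P ((b - a) / 2) k u μ m)
    (hx : m.wordReg wLo < m.wordReg wHi →
      slotWidth u μ ((b - a) / 2) (m.wordReg wLo) (m.wordReg wHi) ≤ m.realReg rBest)
    (hlo : m.wordReg wLo ≤ k)
    (hgrow : u (m.wordReg wHi) < u (m.wordReg wLo) + 2 * ((b - a) / 2)) :
    HaltsWithin L growWindow m 12 fun m' => SweepState P ((b - a) / 2) k u μ m' ∧
      m'.wordReg wLo = m.wordReg wLo ∧ m'.wordReg wHi = m.wordReg wHi + 1 ∧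
      m.wordReg wHi ≤ k ∧ m'.wordReg wSplit = m.wordReg wSplit := by
  have ⟨hcells, hwords⟩ := hL
  have hhi : m.wordReg wHi ≤ k := by
    by_contra! h
    rw [le_antisymm hS.hi_le h] at hgrow
    exact hgrow.not_ge (hu.add_le_top _ ⟨Nat.zero_le _, hlo⟩)
  have hlohi := hS.lo_le_split.trans hS.split_le_hi
  refine .of_exec ?_ (by decide) ⟨⟨?_, ?_, ?_, ?_, ?_, ?_, ?_, ?_, ?_⟩, ?_, ?_, hhi, ?_⟩
  · simp [growWindow]
    omega
  · exact hS.isRecord.congr fun i hi => by simp [growWindow]; omega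
  · simpa [growWindow] using hS.one_le_lo
  · simpa [growWindow] using hS.lo_le_split
  · simpa [growWindow] using hS.split_le_hi.trans (Nat.le_succ _)
  · simpa [growWindow] using hhi
  · simpa [growWindow] using hS.front
  · simp [growWindow, windowMin_succ_right hS.split_le_hi, hm.margins, hS.back]
  · simpa [growWindow] using hS.room.trans (hu.le (Nat.le_succ _) (by omega))
  · simpa [growWindow] using
      hS.sweptTo.succ_right hu hS.one_le_lo hlohi hS.hi_le hx hgrow
  all_goals simp [growWindow]

/-- Rebuilding the front is paid for by the advance of the split. -/
theorem ensureFront_spec (hL : L.Fits k) (hm : HoldsStrip a b k u μ m)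
    (hS : SweepState P ((b - a) / 2) k u μ m) (hlt : m.wordReg wLo < m.wordReg wHi) :
    ∃ T, HaltsWithin L ensureFront m T fun m' => SweepState P ((b - a) / 2) k u μ m' ∧
      m'.wordReg wLo < m'.wordReg wSplit ∧
      T + 20 * (k + 1 - m'.wordReg wSplit) ≤ 20 * (k + 1 - m.wordReg wSplit) + 30 := by
  have hwords := hL.lt_wordBound
  have ⟨_, _, hls, hsh, hhi, _, _, _, _⟩ := hS
  have hb : (Test.wordLt (.reg wLo) (.reg wSplit)).Legal L m := by
    simp
    omega
  by_cases hsplit : m.wordReg wLo < m.wordReg wSplit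
  · refine ⟨5, .cond (T := 1) hb (fun _ => ?_) fun h => absurd hsplit h⟩
    exact .of_exec trivial le_rfl ⟨hS, hsplit, by simp [Program.exec]; omega⟩
  · refine ⟨_, .cond hb (fun h => absurd h hsplit) fun _ =>
      (rebuildFront_spec hL hm hS).mono le_rfl fun m' hF ⟨hS', heq⟩ => ⟨hS', ?_, ?_⟩⟩
    · rwa [heq, hF.wordReg _ (by decide)]
    · simp [heq]
      omega

theorem shrinkWindow_spec (hL : L.Fits k) (hu : IsSweepable u k ((b - a) / 2))
    (hm : HoldsStrip a b k u μ m) (hS : SweepState P ((b - a) / 2) k u μ m)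
    (hx : m.wordReg wLo < m.wordReg wHi →
      slotWidth u μ ((b - a) / 2) (m.wordReg wLo) (m.wordReg wHi) ≤ m.realReg rBest)
    (hshrink : u (m.wordReg wLo) + 2 * ((b - a) / 2) ≤ u (m.wordReg wHi)) :
    ∃ T, HaltsWithin L shrinkWindow m T fun m' => SweepState P ((b - a) / 2) k u μ m' ∧
      m'.wordReg wLo = m.wordReg wLo + 1 ∧ m'.wordReg wHi = m.wordReg wHi ∧
      T + 20 * (k + 1 - m'.wordReg wSplit) ≤ 20 * (k + 1 - m.wordReg wSplit) + 50 := by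
  have ⟨hcells, hwords⟩ := hL
  have hr := hu.radius_pos
  have hlohi := hS.lo_le_split.trans hS.split_le_hi
  have hlt : m.wordReg wLo < m.wordReg wHi := hlohi.lt_of_ne fun h => by
    rw [← h] at hshrink
    linarith
  obtain ⟨T, hT⟩ := ensureFront_spec hL hm hS hlt
  refine ⟨_, hT.seq (T₂ := 4) fun m₁ hF ⟨hS₁, hsplit, htime⟩ => ?_⟩
  have hlo₁ : m₁.wordReg wLo = m.wordReg wLo := hF.wordReg _ (by decide)
  have hhi₁ : m₁.wordReg wHi = m.wordReg wHi := hF.wordReg _ (by decide)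
  have hbest₁ : m₁.realReg rBest = m.realReg rBest := hF.realReg _ (by decide)
  rw [← hlo₁, ← hhi₁, ← hbest₁] at hx
  rw [← hlo₁, ← hhi₁] at hshrink hlohi
  have hhi := hS₁.hi_le
  have hsh := hS₁.split_le_hi
  refine .of_exec ?_ le_rfl ⟨⟨?_, ?_, ?_, ?_, ?_, ?_, ?_, ?_, ?_⟩, ?_, ?_, ?_⟩
  · simp
    omega
  · simpa using hS₁.isRecord
  · simp
  · simpa using hsplit
  · simpa using hsh
  · simpa using hhi
  · simpa using fun l (hl : m₁.wordReg wLo < l) h => hS₁.front l ⟨hl.le, h⟩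
  · simpa using hS₁.back
  · simpa using hshrink
  · simpa using hS₁.sweptTo.succ_left hu hS₁.one_le_lo hlohi hhi hx hshrink
  · simp [hlo₁]
  · simp [hhi₁]
  · simp
    omega

theorem moveWindow_spec (hL : L.Fits k) (hu : IsSweepable u k ((b - a) / 2))
    (hm : HoldsStrip a b k u μ m) (hS : SweepState P ((b - a) / 2) k u μ m)
    (hx : m.wordReg wLo < m.wordReg wHi →
      slotWidth u μ ((b - a) / 2) (m.wordReg wLo) (m.wordReg wHi) ≤ m.realReg rBest)
    (hlo : m.wordReg wLo ≤ k) :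
    ∃ T, HaltsWithin L moveWindow m T fun m' => SweepState P ((b - a) / 2) k u μ m' ∧
      T + sweepPotential k m' + 200 ≤ sweepPotential k m := by
  have ⟨hcells, hwords⟩ := hL
  have hhi := hS.hi_le
  have hb : (Test.realLt (.get aHeight (.reg wHi))
      (.add (.get aHeight (.reg wLo)) (.mul (.lit 2) (.reg rRadius)))).Legal L m := by
    simp
    omega
  by_cases hgrow : u (m.wordReg wHi) < u (m.wordReg wLo) + 2 * ((b - a) / 2)
  · refine ⟨_, .cond hb (fun _ => (growWindow_spec hL hu hm hS hx hlo hgrow).mono le_rfl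
      fun m' _ ⟨hS', hlo', hhi', hle, hsplit'⟩ => ⟨hS', ?_⟩) fun h => ?_⟩
    · simp only [Test.cost, RealExp.cost, WordExp.cost, sweepPotential, hlo', hhi', hsplit']
      omega
    · simp [hm.heights, hm.radius, hgrow.not_ge] at h
  · obtain ⟨T, hT⟩ := shrinkWindow_spec hL hu hm hS hx (not_lt.1 hgrow)
    refine ⟨_, .cond hb (fun h => ?_) fun _ => hT.mono le_rfl
      fun m' _ ⟨hS', hlo', hhi', htime⟩ => ⟨hS', ?_⟩⟩
    · simp [hm.heights, hm.radius, hgrow] at h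
    · simp only [Test.cost, RealExp.cost, WordExp.cost, sweepPotential, hlo', hhi']
      omega

theorem sweepStep_spec (hL : L.Fits k) (hP : IsStrip P a b k u μ) (hm : HoldsStrip a b k u μ m)
    (hS : SweepState P ((b - a) / 2) k u μ m) (hlo : m.wordReg wLo ≤ k) :
    ∃ T, HaltsWithin L sweepStep m T fun m' => SweepState P ((b - a) / 2) k u μ m' ∧
      m.realReg rBest ≤ m'.realReg rBest ∧
      T + sweepPotential k m' + 10 ≤ sweepPotential k m := by
  have hwords := hL.lt_wordBound
  have hhi := hS.hi_le
  have heval : HaltsWithin L (.cond (.wordLt (.reg wLo) (.reg wHi)) evalWindow .nop) m 154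
      fun m' => SweepState P ((b - a) / 2) k u μ m' ∧ m.realReg rBest ≤ m'.realReg rBest ∧
        (m.wordReg wLo < m.wordReg wHi →
          slotWidth u μ ((b - a) / 2) (m.wordReg wLo) (m.wordReg wHi) ≤ m'.realReg rBest) :=
    .cond (T := 150) (by simp; omega)
      (fun hlt => (evalWindow_spec hL hP hm hS hlt).mono le_rfl
        fun _ _ h => ⟨h.1, h.2.1, fun _ => h.2.2⟩)
      (fun hnot => .of_exec trivial (by decide) ⟨hS, le_rfl, (absurd · hnot)⟩)
  refine heval.exists_seq fun m₁ hF ⟨hS₁, hbest, hx⟩ => ?_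
  have hlo₁ : m₁.wordReg wLo = m.wordReg wLo := hF.wordReg _ (by decide)
  have hhi₁ : m₁.wordReg wHi = m.wordReg wHi := hF.wordReg _ (by decide)
  have hsplit₁ : m₁.wordReg wSplit = m.wordReg wSplit := hF.wordReg _ (by decide)
  obtain ⟨T, hT⟩ := moveWindow_spec hL hP.sweepable (hm.of_frame hF) hS₁ (by rwa [hlo₁, hhi₁])
    (by rwa [hlo₁])
  refine ⟨T, hT.mono le_rfl fun m₂ hF₂ ⟨hS₂, htime⟩ => ⟨hS₂, ?_, ?_⟩⟩
  · rwa [hF₂.realReg _ (by decide)]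
  · simp only [sweepPotential, hlo₁, hhi₁, hsplit₁] at htime ⊢
    omega

theorem initWindow_spec (hL : L.Fits k) (hu : IsSweepable u k ((b - a) / 2))
    (hm : HoldsStrip a b k u μ m) (hR : IsRecord P m.realReg) :
    HaltsWithin L initWindow m 14 fun m' =>
      SweepState P ((b - a) / 2) k u μ m' ∧ sweepPotential k m' = 620 * k := by
  have ⟨hcells, hwords⟩ := hL
  refine .of_exec ?_ (by decide) ⟨⟨hR.congr fun i hi => ?_, ?_, ?_, ?_, ?_, ?_, ?_, ?_, ?_⟩, ?_⟩
  · simp [initWindow]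
    omega
  · simp [initWindow]
    omega
  iterate 4 simp [initWindow]
  · simp [initWindow, hm.radius]
  · simp [initWindow, hm.radius]
  · simpa [initWindow] using hu.bottom_add_le 1 ⟨le_rfl, by omega⟩
  · simpa [initWindow] using SweptTo.initial hu _
  · simp [initWindow, sweepPotential]
    omega

theorem slideWindow_spec (hL : L.Fits k) (hP : IsStrip P a b k u μ) (hm : HoldsStrip a b k u μ m)
    (hR : IsRecord P m.realReg) :
    HaltsWithin L slideWindow m (620 * k + 20)
      (Improves P {w | ∃ t, IsSpanningGap P a b w t} m) := by
  have hwords := hL.lt_wordBound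
  refine ((initWindow_spec hL hP.sweepable hm hR).seq (T₂ := 620 * k + 6) ?_).mono (by omega)
    fun _ _ => id
  rintro m₁ hF₁ ⟨hS₁, hΦ⟩
  have hm₁ := hm.of_frame hF₁
  have hbest₁ : m₁.realReg rBest = m.realReg rBest := hF₁.realReg _ (by decide)
  refine (HaltsWithin.loop (fun m' => SweepState P ((b - a) / 2) k u μ m' ∧
    m.realReg rBest ≤ m'.realReg rBest) (sweepPotential k) ⟨hS₁, hbest₁.ge⟩ ?_ ?_).mono
    (by simp [hΦ]) ?_
  · rintro m' hF ⟨hS', -⟩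
    have := hS'.lo_le_split
    have := hS'.split_le_hi
    have := hS'.hi_le
    simp [(hm₁.of_frame hF).count]
    omega
  · rintro m' hF ⟨hS', hbest⟩ hlt
    have hm' := hm₁.of_frame hF
    simp only [Test.Holds, WordExp.val, hm'.count] at hlt
    obtain ⟨T, hT⟩ := sweepStep_spec hL hP hm' hS' (Nat.lt_succ_iff.1 hlt)
    refine ⟨T, hT.mono le_rfl fun m'' _ ⟨hS'', hbest', htime⟩ =>
      ⟨⟨hS'', hbest.trans hbest'⟩, ?_⟩⟩
    simp only [Test.cost, WordExp.cost]
    omega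
  · rintro m' hF ⟨⟨hS', hbest⟩, hnot⟩
    simp only [Test.Holds, WordExp.val, (hm₁.of_frame hF).count, not_lt] at hnot
    have hlo : m'.wordReg wLo = k + 1 :=
      le_antisymm (hS'.lo_le_split.trans (hS'.split_le_hi.trans hS'.hi_le)) hnot
    refine ⟨hS'.isRecord, hbest, fun w ⟨t, hgap⟩ => ?_⟩
    rw [isSpanningGap_iff_isSlot hP.side hP.image_eq] at hgap
    exact (hlo ▸ hS'.sweptTo).le_of_done hP.sweepable hgap

end

/-! ### The search of all strips -/

/-- Appends the scanned point to the strip, if it lies there. -/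
def appendPoint : Program :=
  .cond (.conj (.realLt (.reg rLeft) (.get aX (.reg wScan)))
      (.realLt (.get aX (.reg wScan)) (.reg rRight)))
    (.setWord wCount (.add (.reg wCount) (.lit 1)) ⨟
      .putReal aHeight (.reg wCount) (.get aY (.reg wScan)) ⨟
      .setReal rTemp (.sub (.get aX (.reg wScan)) (.reg rLeft)) ⨟
      setMin rTemp (.sub (.reg rRight) (.get aX (.reg wScan))) ⨟
      .putReal aMargin (.reg wCount) (.reg rTemp))
    .nop

/-- Appends all points that lie in the strip. -/
def scanPoints : Program := forLoop wScan (.reg wSize) appendPoint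

/-- Lists the points in the strip, between two sentinels. -/
def scanStrip : Program :=
  (.setWord wCount (.lit 0) ⨟ .putReal aHeight (.lit 0) (.mul (.lit (-4)) (.reg rBound))) ⨟
  scanPoints ⨟
  .putReal aHeight (.add (.reg wCount) (.lit 1)) (.mul (.lit 4) (.reg rBound))

/-- Selects the strip between the chosen pair of abscissae. -/
def selectStrip : Program :=
  .setReal rLeft (.get aX (.reg wFst)) ⨟
  .setReal rRight (.get aX (.reg wSnd)) ⨟
  .setReal rRadius (.div (.sub (.reg rRight) (.reg rLeft)) (.lit 2))

/-- Searches the strip between the chosen pair of abscissae. -/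
def sweepStrip : Program := selectStrip ⨟ scanStrip ⨟ slideWindow

/-- Searches the strip between the chosen pair of abscissae, unless the pair is not in order or
consists of the sentinels. -/
def sweepPair : Program :=
  .cond (.conj (.realLt (.get aX (.reg wFst)) (.get aX (.reg wSnd)))
      (.realLt (.sub (.get aX (.reg wSnd)) (.get aX (.reg wFst))) (.mul (.lit 2) (.reg rBound))))
    sweepStrip .nop

/-- Searches the strips between all pairs of abscissae. -/
def sweepAll : Program :=
  forLoop wFst (.add (.reg wSize) (.lit 2)) (forLoop wSnd (.add (.reg wSize) (.lit 2)) sweepPair)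

/-- The points stored in the first `n` entries of the coordinate arrays. -/
def Memory.points (m : Memory) (n : ℕ) : Set (ℝ × ℝ) :=
  (fun i => (m.realArr aX i, m.realArr aY i)) '' Set.Iio n

/-- The memory holds the points of `P` in the first `n` entries of the coordinate arrays, and the
bound `M`. -/
structure HoldsPoints (P : Set (ℝ × ℝ)) (n : ℕ) (M : ℝ) (m : Memory) : Prop where
  size : m.wordReg wSize = n
  bound : m.realReg rBound = M
  points_eq : m.points n = P

/-- In addition the points are ordered by height, and their abscissae are followed by the two
sentinels. -/
structure HoldsSorted (P : Set (ℝ × ℝ)) (n : ℕ) (M : ℝ) (m : Memory) : Prop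
    extends HoldsPoints P n M m where
  abscissae_eq : m.realArr aX '' Set.Iio (n + 2) = abscissae P M
  monotoneOn : MonotoneOn (m.realArr aY) (Set.Iio n)

section

variable {m₁' m₂' : Memory} {P Q : Set (ℝ × ℝ)} {S S' : Set ℝ} {a b M : ℝ} {k n i : ℕ}
  {u μ : ℕ → ℝ} {q : ℝ × ℝ}

theorem Memory.points_congr (hX : Set.EqOn (m'.realArr aX) (m.realArr aX) (Set.Iio n))
    (hY : Set.EqOn (m'.realArr aY) (m.realArr aY) (Set.Iio n)) : m'.points n = m.points n :=
  Set.image_congr fun i hi => by rw [hX hi, hY hi]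

theorem Program.Frame.points_eq {c : Program} (hF : c.Frame m m')
    (ha : ∀ i ∈ [aX, aY], i ∉ c.arrayTargets := by decide) : m'.points n = m.points n :=
  Memory.points_congr (fun _ _ => by rw [hF.realArr aX (ha _ (by simp))])
    fun _ _ => by rw [hF.realArr aY (ha _ (by simp))]

theorem Memory.points_succ :
    m.points (n + 1) = insert (m.realArr aX n, m.realArr aY n) (m.points n) := by
  rw [points, ← Nat.succ_eq_add_one, ← Nat.succ_eq_succ, Order.Iio_succ_eq_insert,
    Set.image_insert_eq, points]

theorem HoldsSorted.of_frame {c : Program} (h : HoldsSorted P n M m) (hF : c.Frame m m')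
    (hw : wSize ∉ c.wordTargets := by decide) (hr : rBound ∉ c.realTargets := by decide)
    (ha : ∀ i ∈ [aX, aY], i ∉ c.arrayTargets := by decide) : HoldsSorted P n M m' := by
  refine ⟨⟨(hF.wordReg _ hw).trans h.size, (hF.realReg _ hr).trans h.bound,
    (hF.points_eq ha).trans h.points_eq⟩, ?_, ?_⟩
  · rw [hF.realArr aX (ha _ (by simp)), h.abscissae_eq]
  · rw [hF.realArr aY (ha _ (by simp))]
    exact h.monotoneOn

theorem ListsStrip.empty : ListsStrip ∅ a b 0 u μ := ⟨by simp, fun l hl => by simp at hl⟩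

theorem ListsStrip.insert_of_notMem (h : ListsStrip P a b k u μ) (hq : q.1 ∉ Set.Ioo a b) :
    ListsStrip (insert q P) a b k u μ := by
  refine ⟨?_, h.monotoneOn⟩
  rw [h.image_eq]
  congr 1
  ext p
  simp only [Set.mem_ofPred_eq, Set.mem_insert_iff]
  constructor
  · exact fun h => ⟨.inr h.1, h.2⟩
  · rintro ⟨rfl | hp, hab⟩
    · exact absurd hab hq
    · exact ⟨hp, hab⟩

theorem ListsStrip.mem_image_snd (h : ListsStrip P a b k u μ) {l : ℕ} (hl : l ∈ Set.Icc 1 k) :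
    u l ∈ Prod.snd '' P := by
  obtain ⟨p, hp, heq⟩ := h.image_eq.subset (Set.mem_image_of_mem _ hl)
  exact ⟨p, hp.1, congrArg Prod.fst heq⟩

theorem ListsStrip.insert_of_mem (h : ListsStrip P a b k u μ) (hq : q.1 ∈ Set.Ioo a b)
    (hP : ∀ p ∈ P, p.2 ≤ q.2) :
    ListsStrip (insert q P) a b (k + 1) (Function.update u (k + 1) q.2)
      (Function.update μ (k + 1) (margin a b q.1)) := by
  have hIcc : Set.Icc 1 (k + 1) = insert (k + 1) (Set.Icc 1 k) := by ext; simp; omega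
  have hold : ∀ l ∈ Set.Icc 1 k, l ≠ k + 1 := fun l hl => by have := hl.2; omega
  have hsep : {p ∈ insert q P | p.1 ∈ Set.Ioo a b} =
      insert q {p ∈ P | p.1 ∈ Set.Ioo a b} := by
    ext p
    simp only [Set.mem_ofPred_eq, Set.mem_insert_iff]
    constructor
    · exact fun ⟨h, hab⟩ => h.imp_right (⟨·, hab⟩)
    · rintro (rfl | h)
      exacts [⟨.inl rfl, hq⟩, ⟨.inr h.1, h.2⟩]
  constructor
  · rw [hIcc, hsep, Set.image_insert_eq, Set.image_insert_eq, ← h.image_eq,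
      Function.update_self, Function.update_self]
    congr 1
    exact Set.image_congr fun l hl => by
      rw [Function.update_of_ne (hold l hl), Function.update_of_ne (hold l hl)]
  · intro l hl l' hl' hll
    rw [hIcc] at hl hl'
    have hle {l : ℕ} (hl : l ∈ Set.Icc 1 k) : u l ≤ q.2 := by
      obtain ⟨p, hp, hpl⟩ := h.mem_image_snd hl
      exact hpl ▸ hP p hp
    rcases hl' with rfl | hl'
    · rcases hl with rfl | hl
      · exact le_rfl
      · rw [Function.update_self, Function.update_of_ne (hold l hl)]
        exact hle hl
    · have hl : l ∈ Set.Icc 1 k := hl.resolve_left fun h => by have := hl'.2; omega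
      rw [Function.update_of_ne (hold l hl), Function.update_of_ne (hold l' hl')]
      exact h.monotoneOn hl hl' hll

/-- A square that spans the strip has side length less than `2 * M`, so it cannot reach both a point
and a sentinel. -/
theorem ListsStrip.isStrip (h : ListsStrip P a b k u μ) (hside : ∃ p ∈ P, p.1 = a ∨ p.1 = b)
    (hab : a < b) (hM : b - a < 2 * M) (hP : ∀ p ∈ P, |p.2| ≤ M) (h0 : u 0 = -4 * M) :
    IsStrip P a b k (Function.update u (k + 1) (4 * M)) μ := by
  have hold {l : ℕ} (hl : l ≤ k) : Function.update u (k + 1) (4 * M) l = u l :=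
    Function.update_of_ne (by omega) _ _
  have hheight {l : ℕ} (hl : l ∈ Set.Icc 1 k) : -M ≤ u l ∧ u l ≤ M := by
    obtain ⟨p, hp, hpl⟩ := h.mem_image_snd hl
    exact hpl ▸ abs_le.1 (hP p hp)
  refine ⟨⟨?_, ?_⟩, hside, by linarith, ?_, fun l hl => ?_, fun l hl => ?_⟩
  · rw [← h.image_eq]
    exact Set.image_congr fun l hl => by rw [hold hl.2]
  · exact h.monotoneOn.congr fun l hl => (hold hl.2).symm
  · exact h.monotoneOn.congr fun l hl => (hold hl.2).symm
  · rw [hold k.zero_le, h0]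
    rcases hl.2.eq_or_lt with rfl | hlt
    · rw [Function.update_self]
      linarith
    · rw [hold (by omega)]
      linarith [hheight ⟨hl.1, Nat.lt_succ_iff.1 hlt⟩]
  · rw [hold hl.2, Function.update_self]
    rcases l.eq_zero_or_pos with rfl | hpos
    · linarith
    · linarith [hheight ⟨hpos, hl.2⟩]

theorem appendPoint_spec (hL : L.Fits n) (hi : m.wordReg wScan < n)
    (hk : m.wordReg wCount ≤ m.wordReg wScan) (hm : MonotoneOn (m.realArr aY) (Set.Iio n))
    (h : ListsStrip (m.points (m.wordReg wScan)) (m.realReg rLeft) (m.realReg rRight)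
      (m.wordReg wCount) (m.realArr aHeight) (m.realArr aMargin)) :
    HaltsWithin L appendPoint m 50 fun m' =>
      m'.wordReg wCount ≤ m.wordReg wScan + 1 ∧
      m'.realArr aHeight 0 = m.realArr aHeight 0 ∧
      ListsStrip (m.points (m.wordReg wScan + 1)) (m.realReg rLeft) (m.realReg rRight)
        (m'.wordReg wCount) (m'.realArr aHeight) (m'.realArr aMargin) := by
  have ⟨hcells, hwords⟩ := hL
  rw [Memory.points_succ]
  refine (HaltsWithin.cond (T := 30) ?_ (fun hin => ?_) fun hout => ?_).mono (by decide)
    fun _ _ => id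
  · simp
    omega
  · refine .of_exec ?_ (by decide) ⟨?_, ?_, ?_⟩
    · simp
      omega
    · simpa using hk
    · simp
    · have hpoints : ∀ p ∈ m.points (m.wordReg wScan), p.2 ≤ m.realArr aY (m.wordReg wScan) := by
        rintro _ ⟨j, hj, rfl⟩
        exact hm (lt_trans hj hi) hi hj.le
      simpa [margin] using h.insert_of_mem (q := (_, _)) hin hpoints
  · exact .of_exec trivial (by decide) ⟨by simp; omega, rfl, h.insert_of_notMem hout⟩

theorem scanPoints_spec (hL : L.Fits n) (hm : HoldsSorted P n M m)
    (hcount : m.wordReg wCount = 0) :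
    HaltsWithin L scanPoints m (58 * n + 6) fun m' =>
      m'.wordReg wCount ≤ n ∧ m'.realArr aHeight 0 = m.realArr aHeight 0 ∧
      ListsStrip P (m.realReg rLeft) (m.realReg rRight) (m'.wordReg wCount)
        (m'.realArr aHeight) (m'.realArr aMargin) := by
  have hwords := hL.lt_wordBound
  rw [← hm.points_eq]
  refine (HaltsWithin.forLoop (T := 50) (fun v m' => m'.wordReg wCount ≤ v ∧
    m'.realArr aHeight 0 = m.realArr aHeight 0 ∧
    ListsStrip (m.points v) (m.realReg rLeft) (m.realReg rRight) (m'.wordReg wCount)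
      (m'.realArr aHeight) (m'.realArr aMargin))
    (N := n) (by omega) (by decide) (fun m' hF => ?_) ?_ ?_).mono (by simp; omega) fun _ _ => id
  · simp [(hm.of_frame hF).size]
    omega
  · simp [hcount, Memory.points, ListsStrip.empty]
  · rintro v hv m' hF rfl ⟨hk, hbottom, hlists⟩
    rw [← hF.points_eq, ← hF.realReg rLeft (by decide), ← hF.realReg rRight (by decide)] at *
    refine (appendPoint_spec hL hv hk (hm.of_frame hF).monotoneOn hlists).mono le_rfl
      fun m'' _ h => ?_
    simpa [hbottom] using h

theorem scanStrip_spec (hL : L.Fits n) (hm : HoldsSorted P n M m) (hP : ∀ p ∈ P, |p.2| ≤ M)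
    (hside : ∃ p ∈ P, p.1 = m.realReg rLeft ∨ p.1 = m.realReg rRight)
    (hlt : m.realReg rLeft < m.realReg rRight)
    (hM : m.realReg rRight - m.realReg rLeft < 2 * M) :
    HaltsWithin L scanStrip m (58 * n + 30) fun m' => m'.wordReg wCount ≤ n ∧
      IsStrip P (m.realReg rLeft) (m.realReg rRight) (m'.wordReg wCount) (m'.realArr aHeight)
        (m'.realArr aMargin) := by
  have ⟨hcells, hwords⟩ := hL
  have hinit : HaltsWithin L
      (.setWord wCount (.lit 0) ⨟ .putReal aHeight (.lit 0) (.mul (.lit (-4)) (.reg rBound))) m 10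
      fun m' => m'.wordReg wCount = 0 ∧ m'.realArr aHeight 0 = -4 * M :=
    .of_exec (by simp; omega) (by decide) (by simp [hm.bound])
  refine (hinit.seq (T₂ := 58 * n + 20) fun m₁ hF₁ ⟨hcount, hbottom⟩ => ?_).mono (by omega)
    fun _ _ => id
  have hm₁ := hm.of_frame hF₁
  refine ((scanPoints_spec hL hm₁ hcount).seq (T₂ := 10)
    fun m₂ hF₂ ⟨hk, hbottom₂, hlists⟩ => ?_).mono (by omega) fun _ _ => id
  rw [hF₁.realReg rLeft (by decide), hF₁.realReg rRight (by decide)] at hlists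
  refine .of_exec ?_ (by decide) ⟨hk, ?_⟩
  · simp
    omega
  · simpa [(hm₁.of_frame hF₂).bound] using
      hlists.isStrip hside hlt hM hP (hbottom₂.trans hbottom)

theorem IsRecord.improves (hR : IsRecord P m.realReg) : Improves P ∅ m m :=
  ⟨hR, le_rfl, by simp⟩

theorem Improves.trans (h : Improves P S m₁ m₂) (h' : Improves Q S' m₂ m₃) :
    Improves Q (S ∪ S') m₁ m₃ where
  isRecord := h'.isRecord
  best_le := h.best_le.trans h'.best_le
  mem_upperBounds := by
    rw [upperBounds_union]
    exact ⟨fun w hw => (h.mem_upperBounds hw).trans h'.best_le, h'.mem_upperBounds⟩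

theorem Improves.congr (h : Improves P S m₁ m₂) (h₁ : m₁'.realReg rBest = m₁.realReg rBest)
    (h₂ : m₂'.realReg = m₂.realReg) : Improves P S m₁' m₂' where
  isRecord := h₂ ▸ h.isRecord
  best_le := by rw [h₁, h₂]; exact h.best_le
  mem_upperBounds := by rw [h₂]; exact h.mem_upperBounds

theorem sweepStrip_spec (hL : L.Fits n) (hm : HoldsSorted P n M m) (hR : IsRecord P m.realReg)
    (hP : ∀ p ∈ P, |p.2| ≤ M) (hi : m.wordReg wFst < n + 2) (hj : m.wordReg wSnd < n + 2)
    (ha : m.realArr aX (m.wordReg wFst) = a) (hb : m.realArr aX (m.wordReg wSnd) = b)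
    (hlt : a < b) (hM : b - a < 2 * M) :
    HaltsWithin L sweepStrip m (678 * n + 70)
      (Improves P {w | ∃ t, IsSpanningGap P a b w t} m) := by
  have ⟨hcells, hwords⟩ := hL
  have habscissa {i : ℕ} (hi : i < n + 2) : m.realArr aX i ∈ abscissae P M :=
    hm.abscissae_eq.subset (Set.mem_image_of_mem _ hi)
  have hside := exists_fst_eq_of_mem_abscissae (ha ▸ habscissa hi) (hb ▸ habscissa hj) hlt hM
  have hselect : HaltsWithin L selectStrip m 20 fun m' => m'.realReg rLeft = a ∧
      m'.realReg rRight = b ∧ m'.realReg rRadius = (b - a) / 2 :=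
    .of_exec (by simp [selectStrip]; omega) (by decide) (by simp [selectStrip, ha, hb])
  refine (hselect.seq (T₂ := 678 * n + 50) ?_).mono (by omega) fun _ _ => id
  rintro m₁ hF₁ ⟨rfl, rfl, hradius⟩
  refine ((scanStrip_spec hL (hm.of_frame hF₁) hP hside hlt hM).seq (T₂ := 620 * n + 20)
    fun m₂ hF₂ ⟨hk, hstrip⟩ => ?_).mono (by omega) fun _ _ => id
  have hholds : HoldsStrip (m₁.realReg rLeft) (m₁.realReg rRight) (m₂.wordReg wCount)
      (m₂.realArr aHeight) (m₂.realArr aMargin) m₂ :=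
    ⟨hF₂.realReg _ (by decide), hF₂.realReg _ (by decide),
      (hF₂.realReg _ (by decide)).trans hradius, rfl, rfl, rfl⟩
  have hR₂ : IsRecord P m₂.realReg := hR.congr fun i hi =>
    (hF₂.realReg i (by decide +revert)).trans (hF₁.realReg i (by decide +revert))
  refine (slideWindow_spec (hL.mono hk) hstrip hholds hR₂).mono (by gcongr)
    fun m₃ _ h => h.congr ?_ rfl
  exact ((hF₂.realReg _ (by decide)).trans (hF₁.realReg _ (by decide))).symm

theorem sweepPair_spec (hL : L.Fits n) (hm : HoldsSorted P n M m) (hR : IsRecord P m.realReg)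
    (hP : ∀ p ∈ P, |p.2| ≤ M) (hi : m.wordReg wFst < n + 2) (hj : m.wordReg wSnd < n + 2)
    (ha : m.realArr aX (m.wordReg wFst) = a) (hb : m.realArr aX (m.wordReg wSnd) = b) :
    HaltsWithin L sweepPair m (678 * n + 90)
      (Improves P {w | a < b ∧ b - a < 2 * M ∧ ∃ t, IsSpanningGap P a b w t} m) := by
  have ⟨hcells, hwords⟩ := hL
  refine (HaltsWithin.cond (T := 678 * n + 70) ?_ (fun htest => ?_) fun htest => ?_).mono
    (by simp; omega) fun _ _ => id
  · simp
    omega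
  · simp only [Test.Holds, RealExp.val, WordExp.val, ha, hb, hm.bound, Rat.cast_ofNat] at htest
    exact (sweepStrip_spec hL hm hR hP hi hj ha hb htest.1 htest.2).mono le_rfl fun m' _ h =>
      ⟨h.isRecord, h.best_le, fun w hw => h.mem_upperBounds hw.2.2⟩
  · simp only [Test.Holds, RealExp.val, WordExp.val, ha, hb, hm.bound, Rat.cast_ofNat] at htest
    exact .of_exec trivial (by simp) ⟨hR, le_rfl, fun w hw => absurd ⟨hw.1, hw.2.1⟩ htest⟩

theorem forLoop_improves {c : Program} {e : WordExp} {N : ℕ} {S : ℕ → Set ℝ}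
    (hN : N + 1 < L.wordBound) (hi : i ∉ c.wordTargets)
    (he : ∀ m', (forLoop i e c).Frame m m' → e.Legal L m' ∧ e.val m' = N)
    (hR : IsRecord P m.realReg)
    (hc : ∀ v < N, ∀ m', (forLoop i e c).Frame m m' → m'.wordReg i = v → IsRecord P m'.realReg →
      HaltsWithin L c m' T (Improves P (S v) m')) :
    HaltsWithin L (forLoop i e c) m (N * (T + e.cost + 7) + e.cost + 5)
      (Improves P (⋃ v < N, S v) m) := by
  refine .forLoop (fun v m' => Improves P (⋃ v' < v, S v') m m') hN hi he ?_
    fun v hv m' hF hm' himp => ?_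
  · simpa using (hR.improves.congr rfl rfl : Improves P ∅ m (m.setWord i 0))
  · refine (hc v hv m' hF hm' himp.isRecord).mono le_rfl fun m'' _ himp' => ?_
    rw [Set.biUnion_lt_succ]
    exact (himp.trans himp').congr rfl rfl

theorem sweepAll_spec (hL : L.Fits n) (hm : HoldsSorted P n M m) (hR : IsRecord P m.realReg)
    (hP : ∀ p ∈ P, |p.2| ≤ M) :
    HaltsWithin L sweepAll m (800 * (n + 2) ^ 3) (Improves P (spanningWidths P M) m) := by
  have hwords := hL.lt_wordBound
  have hlimit {m' : Memory} (hm' : HoldsSorted P n M m') :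
      (WordExp.add (.reg wSize) (.lit 2)).Legal L m' ∧
        (WordExp.add (.reg wSize) (.lit 2)).val m' = n + 2 := by
    simp [hm'.size]
    omega
  let S (i j : ℕ) : Set ℝ := {w | m.realArr aX i < m.realArr aX j ∧
    m.realArr aX j - m.realArr aX i < 2 * M ∧
    ∃ t, IsSpanningGap P (m.realArr aX i) (m.realArr aX j) w t}
  refine (forLoop_improves (T := (n + 2) * (678 * n + 100) + 8) (N := n + 2)
    (S := fun i => ⋃ j < n + 2, S i j) (by omega) (by decide)
    (fun m' hF => hlimit (hm.of_frame hF)) hR ?_).mono ?_ fun m' _ h => ?_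
  · rintro i hi m₁ hF₁ hi₁ hR₁
    have hm₁ := hm.of_frame hF₁
    refine (forLoop_improves (T := 678 * n + 90) (N := n + 2) (S := S i) (by omega) (by decide)
      (fun m' hF => hlimit (hm₁.of_frame hF)) hR₁ ?_).mono (by simp) fun _ _ => id
    rintro j hj m₂ hF₂ hj₂ hR₂
    have hi₂ : m₂.wordReg wFst = i := (hF₂.wordReg _ (by decide)).trans hi₁
    have hX : m₂.realArr aX = m.realArr aX :=
      (hF₂.realArr _ (by decide)).trans (hF₁.realArr _ (by decide))
    exact sweepPair_spec hL (hm₁.of_frame hF₂) hR₂ hP (hi₂ ▸ hi) (hj₂ ▸ hj) (by rw [hi₂, hX])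
      (by rw [hj₂, hX])
  · simp only [WordExp.cost]
    nlinarith [Nat.zero_le (n ^ 3), Nat.zero_le (n ^ 2)]
  · refine ⟨h.isRecord, h.best_le, ?_⟩
    rintro w ⟨a, ha, b, hb, hw⟩
    rw [← hm.abscissae_eq] at ha hb
    obtain ⟨⟨i, hi, rfl⟩, j, hj, rfl⟩ := ha, hb
    exact h.mem_upperBounds (Set.mem_biUnion hi (Set.mem_biUnion hj hw))

end

/-! ### The whole program -/

/-- Exchanges two points. -/
def exchange : Program :=
  .setReal rTemp (.get aX (.reg wFst)) ⨟
  .putReal aX (.reg wFst) (.get aX (.reg wSnd)) ⨟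
  .putReal aX (.reg wSnd) (.reg rTemp) ⨟
  .setReal rTemp (.get aY (.reg wFst)) ⨟
  .putReal aY (.reg wFst) (.get aY (.reg wSnd)) ⨟
  .putReal aY (.reg wSnd) (.reg rTemp)

/-- Exchanges two points that are in the wrong order. -/
def sortStep : Program :=
  .cond (.conj (.wordLt (.reg wFst) (.reg wSnd))
      (.realLt (.get aY (.reg wSnd)) (.get aY (.reg wFst))))
    exchange .nop

/-- Sorts the points by height. -/
def exchangeSort : Program :=
  forLoop wFst (.reg wSize) (forLoop wSnd (.reg wSize) sortStep)

/-- Puts two numbers beyond all abscissae behind the abscissae, so that the two sides of every strip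
can be taken from one array. -/
def putSentinels : Program :=
  .putReal aX (.reg wSize) (.mul (.lit (-1)) (.reg rBound)) ⨟
  .putReal aX (.add (.reg wSize) (.lit 1)) (.reg rBound)

/-- Exchanges the coordinates of a point. -/
def transposePoint : Program :=
  .setReal rTemp (.get aX (.reg wFst)) ⨟
  .putReal aX (.reg wFst) (.get aY (.reg wFst)) ⨟
  .putReal aY (.reg wFst) (.reg rTemp)

/-- Exchanges the coordinates of all points. -/
def transposePoints : Program := forLoop wFst (.reg wSize) transposePoint

/-- Exchanges the coordinates of the center of the best annulus. -/
def transposeCenter : Program :=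
  .setReal rTemp (.reg rCenterX) ⨟
  .setReal rCenterX (.reg rCenterY) ⨟
  .setReal rCenterY (.reg rTemp)

/-- Reflects the points and the best annulus in the diagonal. -/
def transpose : Program := transposePoints ⨟ transposeCenter

/-- Searches the vertical strips through pairs of points and reflects the outcome, so that the
second search is the one of the horizontal strips. -/
def searchStrips : Program := exchangeSort ⨟ putSentinels ⨟ sweepAll ⨟ transpose

/-- Computes a bound for the coordinates of the points. There is no absolute value among the
operations, hence the squares. -/
def computeBound : Program :=
  forLoop wFst (.reg wSize)
    (.setReal rBound (.add (.reg rBound)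
      (.add (.mul (.lit 4) (.mul (.get aX (.reg wFst)) (.get aX (.reg wFst))))
        (.add (.mul (.lit 4) (.mul (.get aY (.reg wFst)) (.get aY (.reg wFst)))) (.lit 5)))))

/-- Finds a valid empty square annulus of maximum width among the points. -/
def maxWidthAnnulus : Program := computeBound ⨟ searchStrips ⨟ searchStrips

/-- The loop invariant of the sort: the entries before `i` are in place, and the `i`-th entry is the
minimum of those from `i` to before `j`. -/
structure IsSelected (Y : ℕ → ℝ) (n i j : ℕ) : Prop where
  le_of_lt : ∀ q < i, ∀ r < n, q ≤ r → Y q ≤ Y r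
  le : ∀ r < j, i ≤ r → Y i ≤ Y r

section

variable {P : Set (ℝ × ℝ)} {M : ℝ} {n i j : ℕ} {Y : ℕ → ℝ}

theorem HoldsPoints.of_frame {c : Program} (h : HoldsPoints P n M m) (hF : c.Frame m m')
    (hpoints : m'.points n = P) (hw : wSize ∉ c.wordTargets := by decide)
    (hr : rBound ∉ c.realTargets := by decide) : HoldsPoints P n M m' :=
  ⟨(hF.wordReg _ hw).trans h.size, (hF.realReg _ hr).trans h.bound, hpoints⟩

theorem IsSelected.exchange (h : IsSelected Y n i j) (hij : i < j) (hj : j < n) (hlt : Y j < Y i) :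
    IsSelected (Y ∘ Equiv.swap i j) n i (j + 1) where
  le_of_lt q hq r hr hqr := by
    rw [Function.comp, Function.comp, Equiv.swap_apply_of_ne_of_ne hq.ne (hq.trans hij).ne]
    exact h.le_of_lt q hq _ (by grind) (by grind)
  le r hr hir := by
    rw [Function.comp, Function.comp, Equiv.swap_apply_left]
    rcases eq_or_ne r j with rfl | hrj
    · rw [Equiv.swap_apply_right]
      exact hlt.le
    · rcases hir.eq_or_lt with rfl | hir
      · rw [Equiv.swap_apply_left]
      · rw [Equiv.swap_apply_of_ne_of_ne hir.ne' hrj]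
        exact hlt.le.trans (h.le r (by omega) hir.le)

theorem IsSelected.succ_right (h : IsSelected Y n i j) (hle : i < j → Y i ≤ Y j) :
    IsSelected Y n i (j + 1) where
  le_of_lt := h.le_of_lt
  le r hr hir := by
    rcases (Nat.lt_succ_iff.1 hr).eq_or_lt with rfl | hr
    · exact hir.eq_or_lt.elim (fun h => h ▸ le_rfl) hle
    · exact h.le r hr hir

theorem IsSelected.succ_left (h : IsSelected Y n i n) : IsSelected Y n (i + 1) 0 where
  le_of_lt q hq r hr hqr := by
    rcases (Nat.lt_succ_iff.1 hq).eq_or_lt with rfl | hq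
    · exact h.le r hr hqr
    · exact h.le_of_lt q hq r hr hqr
  le r hr := absurd hr r.not_lt_zero

theorem exchange_spec (hL : L.Fits n) (hi : m.wordReg wFst < n) (hj : m.wordReg wSnd < n) :
    HaltsWithin L exchange m 30 fun m' => m'.points n = m.points n ∧
      m'.realArr aY = m.realArr aY ∘ Equiv.swap (m.wordReg wFst) (m.wordReg wSnd) := by
  have ⟨hcells, hwords⟩ := hL
  refine .of_exec ?_ (by decide) ?_
  · simp [exchange]
    omega
  · have hX : (exchange.exec m).realArr aX =
        m.realArr aX ∘ Equiv.swap (m.wordReg wFst) (m.wordReg wSnd) := by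
      rw [Equiv.swap_comm, Equiv.comp_swap_eq_update]
      simp [exchange]
    have hY : (exchange.exec m).realArr aY =
        m.realArr aY ∘ Equiv.swap (m.wordReg wFst) (m.wordReg wSnd) := by
      rw [Equiv.swap_comm, Equiv.comp_swap_eq_update]
      simp [exchange]
    have himage := (Equiv.swap_bijOn_self (iff_of_true hi hj : _ ∈ Set.Iio n ↔ _)).image_eq
    refine ⟨?_, hY⟩
    rw [Memory.points, hX, hY, Memory.points]
    nth_rewrite 2 [← himage]
    rw [Set.image_image]
    rfl

theorem sortStep_spec (hL : L.Fits n) (hi : m.wordReg wFst < n) (hj : m.wordReg wSnd < n)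
    (h : IsSelected (m.realArr aY) n (m.wordReg wFst) (m.wordReg wSnd)) :
    HaltsWithin L sortStep m 50 fun m' => m'.points n = m.points n ∧
      IsSelected (m'.realArr aY) n (m.wordReg wFst) (m.wordReg wSnd + 1) := by
  have ⟨hcells, hwords⟩ := hL
  refine (HaltsWithin.cond (T := 30) ?_ (fun hlt => ?_) fun hle => ?_).mono (by decide)
    fun _ _ => id
  · simp
    omega
  · refine (exchange_spec hL hi hj).mono le_rfl fun m' _ ⟨hpoints, hY⟩ => ⟨hpoints, ?_⟩
    rw [hY]
    exact h.exchange hlt.1 hj hlt.2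
  · exact .of_exec trivial (by decide) ⟨rfl, h.succ_right fun hij => not_lt.1 fun hlt =>
      hle ⟨hij, hlt⟩⟩

theorem exchangeSort_spec (hL : L.Fits n) (hm : m.wordReg wSize = n) :
    HaltsWithin L exchangeSort m (100 * (n + 2) ^ 2) fun m' => m'.points n = m.points n ∧
      MonotoneOn (m'.realArr aY) (Set.Iio n) := by
  have hwords := hL.lt_wordBound
  have hlimit {m' : Memory} (hm' : m'.wordReg wSize = n) :
      (WordExp.reg wSize).Legal L m' ∧ (WordExp.reg wSize).val m' = n := by
    simp [hm']
    omega
  refine (HaltsWithin.forLoop (T := n * 58 + 6) (fun v m' => m'.points n = m.points n ∧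
    IsSelected (m'.realArr aY) n v 0) (N := n) (by omega) (by decide)
    (fun m' hF => hlimit ((hF.wordReg _ (by decide)).trans hm)) ?_ ?_).mono ?_ ?_
  · exact ⟨rfl, by simp, by simp⟩
  · rintro i hi m₁ hF₁ hi₁ ⟨hpoints₁, hsel₁⟩
    refine (HaltsWithin.forLoop (T := 50) (fun v m' => m'.points n = m.points n ∧
      IsSelected (m'.realArr aY) n i v) (N := n) (by omega) (by decide)
      (fun m' hF => hlimit ((hF.wordReg _ (by decide)).trans
        ((hF₁.wordReg _ (by decide)).trans hm))) ⟨hpoints₁, hsel₁⟩ ?_).mono (by simp)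
      fun m' _ ⟨hpoints, hsel⟩ => ⟨hpoints, hsel.succ_left⟩
    rintro j hj m₂ hF₂ rfl ⟨hpoints₂, hsel₂⟩
    obtain rfl : m₂.wordReg wFst = i := (hF₂.wordReg _ (by decide)).trans hi₁
    exact (sortStep_spec hL hi hj hsel₂).mono le_rfl fun m' _ h => ⟨h.1.trans hpoints₂, h.2⟩
  · simp only [WordExp.cost]
    nlinarith
  · exact fun m' _ ⟨hpoints, hsel⟩ => ⟨hpoints, fun q hq r hr hqr => hsel.le_of_lt q hq r hr hqr⟩

theorem putSentinels_spec (hL : L.Fits n) (hm : HoldsPoints P n M m)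
    (hsorted : MonotoneOn (m.realArr aY) (Set.Iio n)) :
    HaltsWithin L putSentinels m 20 (HoldsSorted P n M) := by
  have ⟨hcells, hwords⟩ := hL
  refine .of_exec ?_ (by decide) ?_
  · simp [putSentinels, hm.size]
    omega
  · have hX : (putSentinels.exec m).realArr aX =
        Function.update (Function.update (m.realArr aX) n (-M)) (n + 1) M := by
      simp [putSentinels, hm.size, hm.bound]
    have hold : Set.EqOn ((putSentinels.exec m).realArr aX) (m.realArr aX) (Set.Iio n) := by
      intro q hq
      rw [Set.mem_Iio] at hq
      rw [hX, Function.update_of_ne (by omega), Function.update_of_ne (by omega)]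
    have hIio : Set.Iio (n + 2) = {n, n + 1} ∪ Set.Iio n := by ext; simp; omega
    refine ⟨⟨hm.size, hm.bound, ?_⟩, ?_, hsorted⟩
    · exact (Memory.points_congr hold fun _ _ => rfl).trans hm.points_eq
    · rw [hIio, Set.image_union, Set.image_congr hold, Set.image_pair, hX, abscissae,
        ← hm.points_eq, Memory.points, Set.image_image]
      simp

theorem transposePoints_spec (hL : L.Fits n) (hm : m.wordReg wSize = n) :
    HaltsWithin L transposePoints m (30 * n + 10) fun m' =>
      m'.points n = Prod.swap '' m.points n := by
  have ⟨hcells, hwords⟩ := hL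
  refine (HaltsWithin.forLoop (T := 20) (fun v m' => ∀ q,
    (m'.realArr aX q = if q < v then m.realArr aY q else m.realArr aX q) ∧
      m'.realArr aY q = if q < v then m.realArr aX q else m.realArr aY q)
    (N := n) (by omega) (by decide) (fun m' hF => ?_) (by simp) ?_).mono (by simp; omega) ?_
  · simp [(hF.wordReg wSize (by decide)).trans hm]
    omega
  · rintro v hv m' - rfl hm'
    refine .of_exec ?_ (by decide) fun q => ?_
    · simp [transposePoint]
      omega
    · have := hm' q
      simp [transposePoint, Function.update_apply]
      grind
  · intro m' _ hm'
    rw [Memory.points, Memory.points, Set.image_image]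
    refine Set.image_congr fun q hq => ?_
    rw [Set.mem_Iio] at hq
    rw [(hm' q).1, (hm' q).2, if_pos hq, if_pos hq, Prod.swap_prod_mk]

theorem transposeCenter_spec (hR : IsRecord P m.realReg) :
    HaltsWithin L transposeCenter m 10 fun m' => IsRecord (Prod.swap '' P) m'.realReg := by
  have hisometry : Isometry (Prod.swap : ℝ × ℝ → ℝ × ℝ) := Isometry.of_dist_eq fun p q => by
    simp [Prod.dist_eq, max_comm]
  refine .of_exec (by simp [transposeCenter]) (by decide)
    ⟨?_, fun hpos => ?_, fun hpos => ?_⟩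
  · simpa [transposeCenter] using hR.nonneg
  · simpa [transposeCenter] using
      (hR.isValidGap (by simpa [transposeCenter] using hpos)).image hisometry
  · simpa [transposeCenter] using hR.sub_eq (by simpa [transposeCenter] using hpos)

theorem searchStrips_spec (hL : L.Fits n) (hm : HoldsPoints P n M m) (hR : IsRecord P m.realReg)
    (hP : ∀ p ∈ P, |p.2| ≤ M) :
    HaltsWithin L searchStrips m (2000 * (n + 2) ^ 3) fun m' =>
      HoldsPoints (Prod.swap '' P) n M m' ∧
        Improves (Prod.swap '' P) (spanningWidths P M) m m' := by
  have htime : (n + 2) ^ 2 ≤ (n + 2) ^ 3 ∧ n + 2 ≤ (n + 2) ^ 3 ∧ 1 ≤ (n + 2) ^ 3 :=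
    ⟨by gcongr <;> omega, Nat.le_self_pow (by omega) _, Nat.one_le_pow _ _ (by omega)⟩
  refine ((exchangeSort_spec hL hm.size).seq (T₂ := 1900 * (n + 2) ^ 3)
    fun m₁ hF₁ ⟨hpoints₁, hsorted₁⟩ => ?_).mono (by omega) fun _ _ => id
  have hm₁ := hm.of_frame hF₁ (hpoints₁.trans hm.points_eq)
  refine ((putSentinels_spec hL hm₁ hsorted₁).seq (T₂ := 1880 * (n + 2) ^ 3)
    fun m₂ hF₂ hm₂ => ?_).mono (by omega) fun _ _ => id
  have hreg₂ (i) (hi : i ≤ 4) : m₂.realReg i = m.realReg i :=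
    (hF₂.realReg i (by decide +revert)).trans (hF₁.realReg i (by decide +revert))
  refine ((sweepAll_spec hL hm₂ (hR.congr hreg₂) hP).seq (T₂ := 1000 * (n + 2) ^ 3)
    fun m₃ hF₃ h₃ => ?_).mono (by omega) fun _ _ => id
  have hm₃ := hm₂.of_frame hF₃
  refine ((transposePoints_spec hL hm₃.size).seq (T₂ := 10)
    fun m₄ hF₄ hpoints₄ => ?_).mono (by omega) fun _ _ => id
  have hR₄ : IsRecord P m₄.realReg :=
    h₃.isRecord.congr fun i hi => hF₄.realReg i (by decide +revert)
  refine (transposeCenter_spec hR₄).mono le_rfl fun m₅ hF₅ hR₅ => ?_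
  have hbest₅ : m₅.realReg rBest = m₃.realReg rBest :=
    (hF₅.realReg _ (by decide)).trans (hF₄.realReg _ (by decide))
  refine ⟨⟨?_, ?_, ?_⟩, hR₅, ?_, ?_⟩
  · exact (hF₅.wordReg _ (by decide)).trans ((hF₄.wordReg _ (by decide)).trans hm₃.size)
  · exact (hF₅.realReg _ (by decide)).trans ((hF₄.realReg _ (by decide)).trans hm₃.bound)
  · rw [hF₅.points_eq, hpoints₄, hm₃.points_eq]
  · rw [hbest₅, ← hreg₂ 4 le_rfl]
    exact h₃.best_le
  · rw [hbest₅]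
    exact h₃.mem_upperBounds

theorem eight_mul_norm_add_one_le (p : ℝ × ℝ) :
    8 * ‖p‖ + 1 ≤ 4 * (p.1 * p.1) + (4 * (p.2 * p.2) + 5) := by
  have habs (x : ℝ) : 8 * |x| ≤ 4 * (x * x) + 4 := by
    rw [← abs_mul_abs_self x]
    linarith [mul_self_nonneg (|x| - 1)]
  rw [Prod.norm_def, Real.norm_eq_abs, Real.norm_eq_abs]
  rcases max_choice |p.1| |p.2| with h | h <;> rw [h]
  · linarith [habs p.1, mul_self_nonneg p.2]
  · linarith [habs p.2, mul_self_nonneg p.1]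

theorem computeBound_spec (hL : L.Fits n) (hm : m.wordReg wSize = n) (h0 : m.realReg rBound = 0) :
    HaltsWithin L computeBound m (50 * n + 10) fun m' =>
      ∀ p ∈ m.points n, 8 * ‖p‖ + 1 ≤ m'.realReg rBound := by
  have ⟨hcells, hwords⟩ := hL
  refine (HaltsWithin.forLoop (T := 30) (fun v m' =>
    0 ≤ m'.realReg rBound ∧ ∀ p ∈ m.points v, 8 * ‖p‖ + 1 ≤ m'.realReg rBound)
    (N := n) (by omega) (by decide) (fun m' hF => ?_) ?_ ?_).mono (by simp; omega)
    fun _ _ => And.right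
  · simp [(hF.wordReg wSize (by decide)).trans hm]
    omega
  · simp [h0, Memory.points]
  · rintro v hv m' hF rfl ⟨hnonneg, hbound⟩
    rw [← hF.points_eq] at hbound ⊢
    refine .of_exec (by simp; omega) (by decide) ?_
    let q := (m'.realArr aX (m'.wordReg wFst), m'.realArr aY (m'.wordReg wFst))
    have hq : 8 * ‖q‖ + 1 ≤ _ := eight_mul_norm_add_one_le q
    have hq' := norm_nonneg q
    simp only [Program.exec, RealExp.val, WordExp.val, Memory.realReg_setWord,
      Memory.realReg_setReal, if_true, Memory.points_succ, Set.forall_mem_insert, Rat.cast_ofNat]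
    exact ⟨by linarith, by linarith, fun p hp => by linarith [hbound p hp]⟩

theorem maxWidthAnnulus_spec (hL : L.Fits n) (hm : m.wordReg wSize = n)
    (h0 : m.realReg rBound = 0) (hbest : m.realReg rBest = 0) :
    HaltsWithin L maxWidthAnnulus m (5000 * (n + 2) ^ 3) fun m' =>
      IsRecord (m.points n) m'.realReg ∧
        ∀ z s r, IsValidGap (m.points n) z s r → r - s ≤ m'.realReg rBest := by
  have htime : n + 2 ≤ (n + 2) ^ 3 := Nat.le_self_pow (by omega) _
  have hfinite : (m.points n).Finite := (Set.finite_Iio n).image _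
  refine ((computeBound_spec hL hm h0).seq (T₂ := 4900 * (n + 2) ^ 3)
    fun m₁ hF₁ hbound => ?_).mono (by omega) fun _ _ => id
  obtain ⟨M, hM⟩ : ∃ M, m₁.realReg rBound = M := ⟨_, rfl⟩
  rw [hM] at hbound
  have habs {p : ℝ × ℝ} (hp : p ∈ m.points n) : |p.1| ≤ M ∧ |p.2| ≤ M := by
    have := hbound p hp
    have := norm_nonneg p
    exact ⟨(norm_fst_le p).trans (by linarith), (norm_snd_le p).trans (by linarith)⟩
  have hm₁ : HoldsPoints (m.points n) n M m₁ :=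
    ⟨(hF₁.wordReg _ (by decide)).trans hm, hM, hF₁.points_eq⟩
  have hbest₁ : m₁.realReg rBest = 0 := (hF₁.realReg _ (by decide)).trans hbest
  have hR₁ : IsRecord (m.points n) m₁.realReg := by constructor <;> simp [hbest₁]
  refine ((searchStrips_spec hL hm₁ hR₁ fun p hp => (habs hp).2).seq (T₂ := 2000 * (n + 2) ^ 3)
    fun m₂ _ ⟨hm₂, h₂⟩ => ?_).mono (by omega) fun _ _ => id
  refine (searchStrips_spec hL hm₂ h₂.isRecord ?_).mono le_rfl fun m₃ _ ⟨_, h₃⟩ => ?_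
  · rintro _ ⟨p, hp, rfl⟩
    exact (habs hp).1
  have h₁₃ := h₂.trans h₃
  rw [Set.image_image] at h₁₃
  simp only [Prod.swap_swap, Set.image_id'] at h₁₃
  refine ⟨h₁₃.isRecord, fun z s r hgap => h₁₃.mem_upperBounds ?_⟩
  exact hgap.sub_mem_spanningWidths hfinite (K := (M - 1) / 8)
    (fun p hp => by linarith [hbound p hp]) (by linarith)

theorem Memory.points_input (p : Fin n → ℝ × ℝ) : (input p).points n = Set.range p := by
  refine Set.Subset.antisymm ?_ ?_
  · rintro _ ⟨i, hi, rfl⟩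
    rw [Set.mem_Iio] at hi
    exact ⟨⟨i, hi⟩, by simp [input, hi]⟩
  · rintro _ ⟨i, rfl⟩
    exact ⟨i, i.isLt, by simp [input]⟩

theorem IsRecord.exists_outputs (hR : IsRecord P m.realReg) (hgap : ∃ z s r, IsValidGap P z s r)
    (hmax : ∀ z s r, IsValidGap P z s r → r - s ≤ m.realReg rBest) :
    ∃ A : SquareAnnulus, m.Outputs A ∧ A.IsMaxWidthValidEmpty P := by
  obtain ⟨z, s, r, hzsr⟩ := hgap
  have hpos : 0 < m.realReg rBest := (sub_pos.2 hzsr.lt).trans_le (hmax z s r hzsr)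
  have hbest := hR.isValidGap hpos
  let A : SquareAnnulus := ⟨(m.realReg rCenterX, m.realReg rCenterY), m.realReg rOuter,
    m.realReg rInner, hbest.nonneg, hbest.lt.le⟩
  obtain ⟨hempty, hvalid⟩ := (A.isEmptyOf_and_isValidFor_iff P (sub_pos.2 hbest.lt)).2 hbest
  refine ⟨A, ⟨rfl, rfl, rfl, rfl⟩, hempty, hvalid, fun B hB hB' => ?_⟩
  rw [show A.width = m.realReg rBest from hR.sub_eq hpos]
  rcases le_or_gt B.width 0 with hw | hw
  · exact hw.trans hpos.le
  · exact hmax _ _ _ ((B.isEmptyOf_and_isValidFor_iff P hw).1 ⟨hB, hB'⟩)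

theorem Limits.fits_mul_pow {C : ℕ} (hC : 4 ≤ C) (hn : 2 ≤ n) : Fits ⟨C * n, n ^ C⟩ n where
  le_cells := by
    change n + 2 ≤ C * n
    nlinarith
  lt_wordBound :=
    calc n + 3 < 2 ^ 2 * n := by omega
      _ ≤ n ^ 2 * n := by gcongr
      _ ≤ n ^ C := by
        rw [← pow_succ]
        exact Nat.pow_le_pow_right (by omega) (by omega)

end

end RealRAM

/-- There is one real-RAM program that, on every set of `n ≥ 2` points of the plane, outputs
a maximum-width valid empty axis-parallel square annulus in at most `C * n ^ 3` steps, while it uses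
at most `C * n` cells of each of its (finitely many) arrays and only words below `n ^ C`. -/
theorem mainTheorem1 :
    ∃ (prog : RealRAM.Program) (C : ℕ),
      ∀ (n : ℕ) (p : Fin n → ℝ × ℝ), 2 ≤ n → Function.Injective p →
        ∃ (t : ℕ) (m : RealRAM.Memory),
          RealRAM.Run ⟨C * n, n ^ C⟩ prog (RealRAM.Memory.input p) t m ∧
          t ≤ C * n ^ 3 ∧
          ∃ A : SquareAnnulus, m.Outputs A ∧ A.IsMaxWidthValidEmpty (Set.range p) := by
  -- A literal in place of `C` would make unification evaluate `n ^ C`.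
  obtain ⟨C, hC⟩ : ∃ C, 40000 ≤ C := ⟨_, le_rfl⟩
  refine ⟨RealRAM.maxWidthAnnulus, C, fun n p hn hp => ?_⟩
  have : Nontrivial (Fin n) := Fin.nontrivial_iff_two_le.2 hn
  have hL : RealRAM.Limits.Fits ⟨C * n, n ^ C⟩ n := RealRAM.Limits.fits_mul_pow (by omega) hn
  obtain ⟨t, ht, m, hrun, hR, hmax⟩ :=
    RealRAM.maxWidthAnnulus_spec (m := RealRAM.Memory.input p) hL rfl rfl rfl
  rw [RealRAM.Memory.points_input] at hR hmax
  refine ⟨t, m, hrun, ?_, hR.exists_outputs ?_ hmax⟩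
  · calc
      t ≤ 5000 * (n + 2) ^ 3 := ht
      _ ≤ 5000 * (2 * n) ^ 3 := by gcongr; omega
      _ = 40000 * n ^ 3 := by ring
      _ ≤ C * n ^ 3 := by gcongr
  · have hnontrivial := Set.nontrivial_univ.image hp
    exact exists_isValidGap (Set.finite_range p) (Set.image_univ ▸ hnontrivial)
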